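/- **Theorem (Coarse-scale behavior of $\gamma$-order linear processes).** Let $d\ge 1$, and let $\mathcal S=\mathcal S(\mathbb R^d)$ be the real Schwartz space and $\mathcal S'$ its dual. A generalized random process is a linear map $\varphi\mapsto\langle s,\varphi\rangle$ from $\mathcal S$ to $L^0(\Omega)$ that is sequentially continuous in probability; its characteristic functional is $\widehat{\mathscr P}_s(\varphi)=\mathbb E[e^{i\langle s,\varphi\rangle}]$, and $\langle s(\cdot/a),\varphi\rangle=a^d\langle s,\varphi(a\,\cdot)\rangle$. Equality and convergence in law of processes are those of all finite-dimensional marginals. Let $w$ be a Lévy white noise with Lévy exponent $\Psi$: $\Psi:\mathbb R\to\mathbb C$ is continuous, $\Psi(0)=0$, $e^{\Psi}$ is the characteristic function of an infinitely divisible random variable $X$ with $\mathbb E|X|^\epsilon<\infty$ for some $\epsilon>0$, and $w$ is a generalized random process with $\widehat{\mathscr P}_w(\varphi)=\exp\big(\int_{\mathbb R^d}\Psi(\varphi(x))\,dx\big)$. Assume that its Pruitt index $$\beta_0=\sup\Big\{p\in[0,2]:\ \limsup_{\xi\to0}\frac{|\Psi(\xi)|}{|\xi|^p}<\infty\Big\}$$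 lies in $(0,2]$. Let $\gamma\ge0$ and let $L:\mathcal S\to\mathcal S'$ be linear, continuous and $\gamma$-homogeneous, i.e. $L\{\varphi(\cdot/a)\}=a^{-\gamma}(L\varphi)(\cdot/a)$ for all $\varphi\in\mathcal S$, $a>0$, with adjoint $L^*:\mathcal S\to\mathcal S'$, $\langle L^*\varphi_1,\varphi_2\rangle=\langle\varphi_1,L\varphi_2\rangle$. Let $T$ be a linear operator from $\mathcal S+L^*(\mathcal S)\subset\mathcal S'$ (which is just $\mathcal S$ if $L^*(\mathcal S)\subset\mathcal S$) to measurable functions on $\mathbb R^d$ modulo null sets such that $TL^*\varphi=\varphi$ for all $\varphi\in\mathcal S$, such that $T$ is $(-\gamma)$-homogeneous on $\mathcal S$, i.e. $T\{\varphi(\cdot/a)\}=a^{\gamma}(T\varphi)(\cdot/a)$ for all $\varphi\in\mathcal S$, $a>0$, and such that $T$ does not vanish identically on $\mathcal S$ (this is automatic if $L^*\varphi\in\mathcal S$ for some $\varphi\in\mathcal S\setminus\{0\}$). Assume that one of the following holds. * **(C1)** $T$ maps $\mathcal S$ continuously into $\mathcal R(\mathbb R^d)=\{f:\ (1+|\cdot|)^Nf\in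 L^2(\mathbb R^d)\ \text{for all } N\in\mathbb N\}$ (with its projective limit topology). * **(C2)** $T$ maps $\mathcal S$ continuously into $L^{\beta_0}(\mathbb R^d)$, and $\Psi$ is $\beta_0$-admissible: there is $C'>0$ with $|\Psi(\xi)|\le C'|\xi|^{\beta_0}$ for all $\xi\in\mathbb R$. Let $s=L^{-1}w$ be the linear process with characteristic functional $\widehat{\mathscr P}_s(\varphi)=\widehat{\mathscr P}_w(T\varphi)=\exp\big(\int\Psi(T\varphi(x))\,dx\big)$, $\varphi\in\mathcal S$. Suppose that $\Psi(\xi)\sim -C|\xi|^{\beta_0}$ as $\xi\to0$ for some $C>0$, and put $H_\infty=\gamma+d\big(\tfrac1{\beta_0}-1\big)$. Then $$a^{H_\infty}\,s(\cdot/a)\ \xrightarrow[a\to0^+]{(d)}\ s_{L,\beta_0},$$ where $s_{L,\beta_0}$ is a linear random process on $\mathcal S+L^*(\mathcal S)$ with $\mathbb E[e^{i\langle s_{L,\beta_0},\psi\rangle}]=\exp\big(-C\int|T\psi(x)|^{\beta_0}dx\big)$ for all $\psi\in\mathcal S+L^*(\mathcal S)$ (such a process exists, the integrals are finite), whose restriction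 to $\mathcal S$ is a generalized random process that is self-similar of order $H_\infty$ (that is, $a^{H_\infty}s_{L,\beta_0}(\cdot/a)$ has the law of $s_{L,\beta_0}$ for all $a>0$), and which solves $L s_{L,\beta_0}\overset{(d)}{=}w_{\beta_0}$: the process $\varphi\mapsto\langle s_{L,\beta_0},L^*\varphi\rangle$ is a symmetric $\beta_0$-stable white noise, with characteristic functional $\exp(-C\|\varphi\|_{\beta_0}^{\beta_0})$. In particular $s$ is asymptotically self-similar of order $H_\infty$: $a^{H_\infty}s(\cdot/a)$ converges in law, as $a\to0^+$, to a generalized random process that is not zero. -/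

import Mathlib

open MeasureTheory Filter Topology SchwartzMap

noncomputable section

namespace LevySDE

/-- The space `ℝ^d`. -/
abbrev Space (d : ℕ) : Type := EuclideanSpace ℝ (Fin d)

/-- Real-valued Schwartz functions on `ℝ^d`. -/
abbrev TestFun (d : ℕ) : Type := 𝓢(Space d, ℝ)

/-- Real tempered distributions on `ℝ^d`, with the strong dual topology. -/
abbrev Distr (d : ℕ) : Type := TestFun d →L[ℝ] ℝ

/-! ### Test functions, distributions, dilations -/

/-- The dilated test function `φ(c ·)`, for `c ≠ 0` (and `0` by convention if `c = 0`). -/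
def dilate {d : ℕ} (c : ℝ) : TestFun d →L[ℝ] TestFun d :=
  if hc : c ≠ 0 then
    SchwartzMap.compCLMOfContinuousLinearEquiv ℝ
      (ContinuousLinearEquiv.smulLeft (R₁ := ℝ) (M₁ := Space d) (Units.mk0 c hc))
  else 0

theorem dilate_apply {d : ℕ} {c : ℝ} (hc : c ≠ 0) (φ : TestFun d) (x : Space d) :
    dilate c φ x = φ (c • x) := by
  simp [dilate, hc, Units.smul_def]

/-- The embedding of test functions into distributions, `⟨φ, ψ⟩ = ∫ φ(x) ψ(x) dx`. -/
def toDistr {d : ℕ} : TestFun d →ₗ[ℝ] Distr d where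
  toFun φ := (SchwartzMap.integralCLM ℝ (volume : Measure (Space d))).comp
    (SchwartzMap.pairing (ContinuousLinearMap.mul ℝ ℝ) φ)
  map_add' φ ψ := by ext χ; simp
  map_smul' c φ := by ext χ; simp

theorem toDistr_apply {d : ℕ} (φ ψ : TestFun d) :
    toDistr φ ψ = ∫ x, φ x * ψ x := by
  simp [toDistr]

/-- The dilated distribution `u(· / a)`: `⟨u(· / a), φ⟩ = a^d ⟨u, φ(a ·)⟩`. -/
def Distr.rescale {d : ℕ} (u : Distr d) (a : ℝ) : Distr d :=
  a ^ d • u.comp (dilate a)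

/-- A continuous linear operator `L : 𝓢 → 𝓢'` is `γ`-homogeneous if
`L {φ(· / a)} = a^{-γ} (L φ)(· / a)` for all `φ` and `a > 0`. -/
def IsHomogeneousOperator {d : ℕ} (γ : ℝ) (L : TestFun d →L[ℝ] Distr d) : Prop :=
  ∀ (a : ℝ), 0 < a → ∀ φ : TestFun d,
    L (dilate a⁻¹ φ) = a ^ (-γ) • Distr.rescale (L φ) a

/-- The adjoint `L* : 𝓢 → 𝓢'`, `⟨L* φ₁, φ₂⟩ = ⟨φ₁, L φ₂⟩`. -/
def adjoint {d : ℕ} (L : TestFun d →L[ℝ] Distr d) : TestFun d →ₗ[ℝ] Distr d where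
  toFun φ₁ :=
    { toFun := fun φ₂ => L φ₂ φ₁
      map_add' := fun _ _ => by simp
      map_smul' := fun _ _ => by simp
      cont := (continuous_eval_const φ₁).comp L.continuous }
  map_add' _ _ := by ext; simp
  map_smul' _ _ := by ext; simp

/-- The space `𝓢 + L*(𝓢)` of distributions: the smallest space on which an operator has to be
defined in order to act on `𝓢` and to be a left inverse of `L*`.  It is (the copy in `𝓢'` of) `𝓢`
itself when `L*(𝓢) ⊆ 𝓢`. -/
def extSpace {d : ℕ} (L : TestFun d →L[ℝ] Distr d) : Submodule ℝ (Distr d) :=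
  LinearMap.range (toDistr (d := d)) ⊔ LinearMap.range (adjoint L)

/-- `φ ∈ 𝓢`, seen in `𝓢 + L*(𝓢)`. -/
def inclExt {d : ℕ} (L : TestFun d →L[ℝ] Distr d) : TestFun d →ₗ[ℝ] extSpace L :=
  (toDistr (d := d)).codRestrict (extSpace L) fun φ =>
    Submodule.mem_sup_left (LinearMap.mem_range_self _ φ)

/-- `L* φ`, seen in `𝓢 + L*(𝓢)`. -/
def adjointExt {d : ℕ} (L : TestFun d →L[ℝ] Distr d) : TestFun d →ₗ[ℝ] extSpace L :=
  (adjoint L).codRestrict (extSpace L) fun φ =>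
    Submodule.mem_sup_right (LinearMap.mem_range_self _ φ)

/-! ### Operators with values in function spaces (functions modulo null sets) -/

/-- `T L* φ = φ` for every `φ ∈ 𝓢`. -/
def IsLeftInverseOfAdjoint {d : ℕ} (L : TestFun d →L[ℝ] Distr d)
    (T : extSpace L →ₗ[ℝ] (Space d →ₘ[volume] ℝ)) : Prop :=
  ∀ φ : TestFun d, (T (adjointExt L φ) : Space d → ℝ) =ᵐ[volume] φ

/-- A linear operator `A` from `𝓢` to measurable functions is `δ`-homogeneous if
`A {φ(· / a)} = a^{-δ} (A φ)(· / a)` for all `φ` and `a > 0`. -/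
def IsHomogeneousMap {d : ℕ} (δ : ℝ) (A : TestFun d →ₗ[ℝ] (Space d →ₘ[volume] ℝ)) : Prop :=
  ∀ (a : ℝ), 0 < a → ∀ φ : TestFun d,
    (A (dilate a⁻¹ φ) : Space d → ℝ) =ᵐ[volume] fun x => a ^ (-δ) * (A φ) (a⁻¹ • x)

/-- `A` maps `𝓢` continuously into the space `𝓡` of functions `f` such that
`(1 + |·|)^N f ∈ L²` for all `N`, with its projective limit topology. -/
def ContinuousIntoRapid {d : ℕ} (A : TestFun d →ₗ[ℝ] (Space d →ₘ[volume] ℝ)) : Prop :=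
  (∀ (φ : TestFun d) (N : ℕ), MemLp (fun x => (1 + ‖x‖) ^ N * A φ x) 2 volume) ∧
  ∀ (N : ℕ) (φ₀ : TestFun d),
    Tendsto (fun φ => eLpNorm (fun x => (1 + ‖x‖) ^ N * (A φ x - A φ₀ x)) 2 volume)
      (𝓝 φ₀) (𝓝 0)

/-- `A` maps `𝓢` continuously into the (quasi-normed, if `p < 1`) space `L^p`, `0 < p < ∞`. -/
def ContinuousIntoLp {d : ℕ} (p : ℝ) (A : TestFun d →ₗ[ℝ] (Space d →ₘ[volume] ℝ)) : Prop :=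
  (∀ φ : TestFun d, MemLp (A φ) (ENNReal.ofReal p) volume) ∧
  ∀ φ₀ : TestFun d,
    Tendsto (fun φ => eLpNorm (fun x => A φ x - A φ₀ x) (ENNReal.ofReal p) volume)
      (𝓝 φ₀) (𝓝 0)

/-! ### Lévy exponents -/

/-- A probability measure on `ℝ` is infinitely divisible if it is an `n`-fold convolution power
of a probability measure for every `n ≥ 1`. -/
def IsInfinitelyDivisible (μ : Measure ℝ) : Prop :=
  ∀ n : ℕ, 0 < n → ∃ ν : Measure ℝ, IsProbabilityMeasure ν ∧
    (fun m : Measure ℝ => m.conv ν)^[n] (Measure.dirac 0) = μ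

/-- `Ψ` is the Lévy exponent of the law `μ`: `μ` is infinitely divisible, and `Ψ` is the continuous
logarithm, vanishing at `0`, of its characteristic function. -/
structure IsLevyExponentOf (Ψ : ℝ → ℂ) (μ : Measure ℝ) : Prop where
  isProbabilityMeasure : IsProbabilityMeasure μ
  infinitelyDivisible : IsInfinitelyDivisible μ
  continuous : Continuous Ψ
  map_zero : Ψ 0 = 0
  charFun_eq : ∀ ξ : ℝ, charFun μ ξ = Complex.exp (Ψ ξ)

/-- `Ψ` is the Lévy exponent of an infinitely divisible law with a finite absolute moment of
some order `ε > 0`. -/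
def IsTemperedLevyExponent (Ψ : ℝ → ℂ) : Prop :=
  ∃ μ : Measure ℝ, IsLevyExponentOf Ψ μ ∧
    ∃ ε : ℝ, 0 < ε ∧ ∫⁻ x, ENNReal.ofReal (|x| ^ ε) ∂μ < ⊤

/-- The Pruitt index `β₀ = sup {p ∈ [0,2] : limsup_{ξ → 0} |Ψ(ξ)| / |ξ|^p < ∞}`. -/
def pruittIndex (Ψ : ℝ → ℂ) : ℝ :=
  sSup {p : ℝ | p ∈ Set.Icc (0 : ℝ) 2 ∧
    limsup (fun ξ : ℝ => ENNReal.ofReal (‖Ψ ξ‖ / |ξ| ^ p)) (𝓝[≠] 0) < ⊤}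

/-- `Ψ` is `p`-admissible: `|Ψ(ξ)| ≤ C |ξ|^p` for all `ξ`. -/
def IsAdmissible (p : ℝ) (Ψ : ℝ → ℂ) : Prop :=
  ∃ C : ℝ, 0 < C ∧ ∀ ξ : ℝ, ‖Ψ ξ‖ ≤ C * |ξ| ^ p

/-- The functional `f ↦ exp (∫ Ψ(f(x)) dx)`; on `𝓢` it is the characteristic functional of the
Lévy white noise with exponent `Ψ`, on larger function spaces its extension. -/
def noiseFunctional {d : ℕ} (Ψ : ℝ → ℂ) (f : Space d → ℝ) : ℂ :=
  Complex.exp (∫ x, Ψ (f x))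

/-! ### Generalized random processes -/

section RandomProcesses

variable {d : ℕ} {Ω : Type*} [MeasurableSpace Ω]

/-- A linear map `φ ↦ ⟨s, φ⟩` from `𝓢` to `L⁰(Ω)` is a generalized random process if it is
sequentially continuous in probability. -/
def IsGeneralizedProcess (P : Measure Ω) (s : TestFun d →ₗ[ℝ] (Ω →ₘ[P] ℝ)) : Prop :=
  ∀ (u : ℕ → TestFun d) (φ : TestFun d), Tendsto u atTop (𝓝 φ) →
    TendstoInMeasure P (fun n => (s (u n) : Ω → ℝ)) atTop (s φ)

/-- The characteristic functional `φ ↦ 𝔼 [exp (i ⟨s, φ⟩)]` of a linear map from a real vector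
space to random variables. -/
def charFunctional {V : Type*} [AddCommGroup V] [Module ℝ V] {P : Measure Ω}
    (s : V →ₗ[ℝ] (Ω →ₘ[P] ℝ)) (φ : V) : ℂ :=
  ∫ ω, Complex.exp (Complex.I * ((s φ ω : ℝ) : ℂ)) ∂P

/-- The process `s(· / a)`: `⟨s(· / a), φ⟩ = a^d ⟨s, φ(a ·)⟩`. -/
def rescale {P : Measure Ω} (s : TestFun d →ₗ[ℝ] (Ω →ₘ[P] ℝ)) (a : ℝ) :
    TestFun d →ₗ[ℝ] (Ω →ₘ[P] ℝ) :=
  a ^ d • s.comp (dilate a : TestFun d →L[ℝ] TestFun d).toLinearMap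

/-- Equality in law: all finite-dimensional marginals have the same law. -/
def EqualInLaw {Ω' : Type*} [MeasurableSpace Ω'] {P : Measure Ω} {P' : Measure Ω'}
    (s : TestFun d →ₗ[ℝ] (Ω →ₘ[P] ℝ)) (r : TestFun d →ₗ[ℝ] (Ω' →ₘ[P'] ℝ)) : Prop :=
  ∀ (N : ℕ) (φ : Fin N → TestFun d),
    P.map (fun ω k => s (φ k) ω) = P'.map (fun ω k => r (φ k) ω)

/-- Convergence in law along a filter: all finite-dimensional marginals converge in law. -/
def ConvergesInLaw {Ω' ι : Type*} [MeasurableSpace Ω'] {P : Measure Ω} {P' : Measure Ω'}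
    [IsProbabilityMeasure P] [IsProbabilityMeasure P'] (l : Filter ι)
    (s : ι → TestFun d →ₗ[ℝ] (Ω →ₘ[P] ℝ)) (r : TestFun d →ₗ[ℝ] (Ω' →ₘ[P'] ℝ)) : Prop :=
  ∀ (N : ℕ) (φ : Fin N → TestFun d),
    TendstoInDistribution (fun i ω k => s i (φ k) ω) l (fun ω (k : Fin N) => r (φ k) ω)
      (fun _ => P) P'

/-- `s` is self-similar of order `H`: `a^H s(· / a)` has the law of `s` for all `a > 0`. -/
def IsSelfSimilar {P : Measure Ω} (H : ℝ) (s : TestFun d →ₗ[ℝ] (Ω →ₘ[P] ℝ)) : Prop :=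
  ∀ a : ℝ, 0 < a → EqualInLaw (a ^ H • rescale s a) s

/-- `s` is asymptotically self-similar of order `H`: `a^H s(· / a)` converges in law, as
`a → 0⁺`, to a generalized random process that is not the zero process. -/
def IsAsymptoticallySelfSimilar {P : Measure Ω} [IsProbabilityMeasure P] (H : ℝ)
    (s : TestFun d →ₗ[ℝ] (Ω →ₘ[P] ℝ)) : Prop :=
  ∃ (Ω' : Type) (_ : MeasurableSpace Ω') (P' : Measure Ω') (_ : IsProbabilityMeasure P')
    (r : TestFun d →ₗ[ℝ] (Ω' →ₘ[P'] ℝ)),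
    IsGeneralizedProcess P' r ∧ r ≠ 0 ∧
    ConvergesInLaw (𝓝[>] (0 : ℝ)) (fun a => a ^ H • rescale s a) r

/-- `w` is a Lévy white noise in `𝓢'(ℝ^d)` with Lévy exponent `Ψ`. -/
structure IsLevyWhiteNoise (P : Measure Ω) (Ψ : ℝ → ℂ)
    (w : TestFun d →ₗ[ℝ] (Ω →ₘ[P] ℝ)) : Prop where
  isGeneralizedProcess : IsGeneralizedProcess P w
  exponent : IsTemperedLevyExponent Ψ
  charFunctional_eq : ∀ φ : TestFun d, charFunctional w φ = noiseFunctional Ψ φ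

/-- `w` is a symmetric `α`-stable white noise, with characteristic functional
`exp (- C ‖φ‖_α^α)`, `C > 0`. -/
structure IsStableWhiteNoise (P : Measure Ω) (α C : ℝ)
    (w : TestFun d →ₗ[ℝ] (Ω →ₘ[P] ℝ)) : Prop where
  isGeneralizedProcess : IsGeneralizedProcess P w
  index_mem : α ∈ Set.Ioc (0 : ℝ) 2
  const_pos : 0 < C
  charFunctional_eq : ∀ φ : TestFun d,
    charFunctional w φ = Complex.exp (-(C * ∫ x, |φ x| ^ α : ℝ))

end RandomProcesses

end LevySDE

end

noncomputable section

namespace LevySDE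

/-! ### The Kolmogorov extension theorem for real-valued processes -/

/-! Everything is read off characteristic functionals. By homogeneity of T and a change of variables
(`integral_comp_map_dilate`), that of a^H s(·/a) at φ is exp(ε⁻¹ ∫ Ψ(ε^{1/β₀} Tφ)) with ε = a^d.
Since Ψ(ξ) ~ -C|ξ|^β₀, dominated convergence (`tendsto_inv_mul_integral_comp_rpow_mul`) gives the
limit exp(-C ∫ |Tφ|^β₀). Under (C2) admissibility is the domination. Under (C1) it comes from |Ψ(ξ)|
≤ M(|ξ|^β₀ + ξ²), where the quadratic growth is derived from trigonometric doubling inequalities for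
convolution roots (`IsLevyExponentOf.doubling`), without the Lévy–Khintchine formula.

The limit process is built on 𝓢 + L*(𝓢) by Kolmogorov extension. Its marginals exist because the law
of X itself supplies approximations: if Y has that law and x is drawn independently, sums of n
independent copies of n^{-1/β₀} Y F(x) converge to the required stable vector
(`exists_charFun_eq_exp_neg`). Almost sure linearity, continuity in probability, self-similarity and
nonvanishing all follow from the characteristic functional, and TL* = id identifies L s_{L,β₀}. -/

theorem projectiveFamilyContent_tendsto_zero {ι : Type*}
    {P : ∀ J : Finset ι, Measure (∀ _ : J, ℝ)} [∀ J, IsProbabilityMeasure (P J)]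
    (hP : IsProjectiveMeasureFamily (α := fun _ : ι => ℝ) P)
    {A : ℕ → Set (ι → ℝ)} (A_mem : ∀ n, A n ∈ measurableCylinders (fun _ : ι => ℝ))
    (A_anti : Antitone A) (A_inter : ⋂ n, A n = ∅) :
    Tendsto (fun n => projectiveFamilyContent hP (A n)) atTop (𝓝 0) := by
  have hanti : Antitone fun n => projectiveFamilyContent hP (A n) := fun m n hmn =>
    projectiveFamilyContent_mono hP (A_mem n) (A_mem m) (A_anti hmn)
  have hlim := tendsto_atTop_iInf hanti
  set ε := ⨅ n, projectiveFamilyContent hP (A n) with hε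
  rcases eq_or_ne ε 0 with h0 | h0
  · rwa [h0] at hlim
  exfalso
  have hle : ∀ n, ε ≤ projectiveFamilyContent hP (A n) := fun n => iInf_le _ n
  obtain ⟨δ, hδpos, hδsum⟩ := ENNReal.exists_pos_sum_of_countable h0 ℕ
  choose I S mS A_eq using fun n => (mem_measurableCylinders _).1 (A_mem n)
  -- Inner regularity: the compact sets lose less than ε in total, so no finite intersection of the
  -- corresponding cylinders is empty.
  have hK : ∀ n, ∃ K ⊆ S n, IsCompact K ∧ P (I n) (S n) < P (I n) K + δ n := fun n =>
    (mS n).exists_isCompact_lt_add (measure_ne_top _ _)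
      (ENNReal.coe_ne_zero.2 (hδpos n).ne')
  choose K hKS hKc hKm using hK
  have hx : ∀ n, ∃ x : ι → ℝ, ∀ k ≤ n, (I k).restrict x ∈ K k := by
    intro n
    by_contra! hcon
    have hsub : A n ⊆ ⋃ k ≤ n, cylinder (I k) (S k \ K k) := by
      intro x hx
      obtain ⟨k, hkn, hk⟩ := hcon x
      have hxk : x ∈ A k := A_anti hkn hx
      rw [A_eq k] at hxk
      exact Set.mem_iUnion₂.2 ⟨k, hkn, hxk, hk⟩
    have hmem : ∀ k, cylinder (I k) (S k \ K k) ∈ measurableCylinders (fun _ : ι => ℝ) := fun k =>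
      (mem_measurableCylinders _).2 ⟨I k, _, (mS k).diff (hKc k).measurableSet, rfl⟩
    have hUn : (⋃ k ≤ n, cylinder (I k) (S k \ K k)) ∈ measurableCylinders (fun _ : ι => ℝ) := by
      have := isSetRing_measurableCylinders (α := fun _ : ι => ℝ) |>.biUnion_mem
        (Finset.range (n + 1)) (fun k _ => hmem k)
      simpa [Nat.lt_succ_iff] using this
    have h1 := projectiveFamilyContent_mono hP (A_mem n) hUn hsub
    have h2 := projectiveFamilyContent_iUnion_le hP hmem n
    have h3 : ∑ k ∈ Finset.range (n + 1), projectiveFamilyContent hP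
        (cylinder (I k) (S k \ K k)) ≤ ∑ k ∈ Finset.range (n + 1), (δ k : ENNReal) := by
      refine Finset.sum_le_sum fun k _ => ?_
      rw [projectiveFamilyContent_cylinder hP ((mS k).diff (hKc k).measurableSet),
        measure_sdiff (hKS k) (hKc k).measurableSet.nullMeasurableSet (measure_ne_top _ _),
        tsub_le_iff_left]
      exact (hKm k).le
    exact absurd ((hle n).trans (h1.trans (h2.trans (h3.trans (ENNReal.sum_le_tsum _)))))
      (not_le.2 hδsum)
  choose x hx using hx
  -- A nonprincipal ultrafilter replaces the diagonal extraction.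
  let U : Filter ℕ := (hyperfilter ℕ : Ultrafilter ℕ)
  have hUk : ∀ k, ∀ᶠ n in U, (I k).restrict (x n) ∈ K k := fun k =>
    (Nat.hyperfilter_le_atTop) ((eventually_ge_atTop k).mono fun n hn => hx n k hn)
  have hconv : ∀ k, ∃ y ∈ K k, Tendsto (fun n => (I k).restrict (x n)) U (𝓝 y) := fun k =>
    (hKc k).ultrafilter_le_nhds ((hyperfilter ℕ).map fun n => (I k).restrict (x n))
      (le_principal_iff.2 (hUk k))
  -- On a coordinate outside every `I k` the limit may be a junk value, but no `A n` tests it.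
  let y : ι → ℝ := fun i => limUnder U fun n => x n i
  have hy : ∀ k, (I k).restrict y ∈ K k := by
    intro k
    obtain ⟨z, hz, hlim⟩ := hconv k
    have : (I k).restrict y = z := by
      ext i
      exact ((tendsto_pi_nhds.1 hlim i).limUnder_eq :)
    rwa [this]
  have : y ∈ ⋂ n, A n := Set.mem_iInter.2 fun n => by
    rw [A_eq n]; exact hKS n (hy n)
  simp [A_inter] at this

/-- The **Kolmogorov extension theorem** for real-valued processes. -/
theorem exists_isProjectiveLimit {ι : Type*}
    {P : ∀ J : Finset ι, Measure (∀ _ : J, ℝ)} [∀ J, IsProbabilityMeasure (P J)]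
    (hP : IsProjectiveMeasureFamily (α := fun _ : ι => ℝ) P) :
    ∃ μ : Measure (ι → ℝ), IsProjectiveLimit (α := fun _ : ι => ℝ) μ P := by
  have hσ : (projectiveFamilyContent hP).IsSigmaSubadditive :=
    isSigmaSubadditive_of_addContent_iUnion_eq_tsum isSetRing_measurableCylinders
      fun f hf hf_Union hf' => addContent_iUnion_eq_sum_of_tendsto_zero
        isSetRing_measurableCylinders (projectiveFamilyContent hP)
        (fun s _ => projectiveFamilyContent_ne_top hP)
        (fun _ => projectiveFamilyContent_tendsto_zero hP) hf hf_Union hf'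
  refine ⟨(projectiveFamilyContent hP).measure isSetSemiring_measurableCylinders
    generateFrom_measurableCylinders.ge hσ, fun I => ?_⟩
  ext s hs
  rw [Measure.map_apply (Finset.measurable_restrict I) hs]
  exact (AddContent.measure_eq _ _ generateFrom_measurableCylinders.symm hσ
    ((mem_measurableCylinders _).2 ⟨I, s, hs, rfl⟩)).trans (projectiveFamilyContent_cylinder hP hs)

/-! ### Finite-dimensional stable laws -/

/-- Existence half of Lévy's continuity theorem: continuity of the limit at 0 gives tightness, and
any weak limit along an ultrafilter has the right characteristic function. -/
theorem exists_probabilityMeasure_charFun_eq {E : Type*} [NormedAddCommGroup E]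
    [InnerProductSpace ℝ E] [FiniteDimensional ℝ E] [MeasurableSpace E] [BorelSpace E]
    {μ : ℕ → Measure E} [∀ n, IsProbabilityMeasure (μ n)] {f : E → ℂ} (hf : ContinuousAt f 0)
    (h : ∀ t, Tendsto (fun n => charFun (μ n) t) atTop (𝓝 (f t))) :
    ∃ ρ : Measure E, IsProbabilityMeasure ρ ∧ ∀ t, charFun ρ t = f t := by
  let κ : ℕ → ProbabilityMeasure E := fun n => ⟨μ n, inferInstance⟩
  have htight : IsTightMeasureSet {((ρ : ProbabilityMeasure E) : Measure E) | ρ ∈ Set.range κ} := by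
    convert isTightMeasureSet_of_tendsto_charFun hf h
    ext ρ
    exact Set.exists_range_iff
  obtain ⟨ρ, -, hρ⟩ := (isCompact_closure_of_isTightMeasureSet htight).ultrafilter_le_nhds
    ((hyperfilter ℕ).map κ)
    (le_principal_iff.2 (Eventually.of_forall (f := (hyperfilter ℕ : Filter ℕ))
      fun n => subset_closure (Set.mem_range_self (f := κ) n)))
  refine ⟨ρ, inferInstance, fun t => ?_⟩
  have hlim : Tendsto κ (hyperfilter ℕ : Filter ℕ) (𝓝 ρ) := hρ
  rw [ProbabilityMeasure.tendsto_iff_forall_integral_rclike_tendsto ℂ] at hlim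
  have h1 := hlim (BoundedContinuousFunction.innerProbChar t)
  simp_rw [← charFun_eq_integral_innerProbChar] at h1
  exact tendsto_nhds_unique h1 ((h t).mono_left Nat.hyperfilter_le_atTop)

theorem isProbabilityMeasure_conv_iterate {E : Type*} [AddMonoid E] [MeasurableSpace E]
    [MeasurableAdd₂ E] (ν : Measure E) [IsProbabilityMeasure ν] (n : ℕ) :
    IsProbabilityMeasure ((fun m : Measure E => m.conv ν)^[n] (Measure.dirac 0)) := by
  induction n with
  | zero => simp only [Function.iterate_zero, id_eq]; infer_instance
  | succ n ih => rw [Function.iterate_succ_apply']; infer_instance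

theorem charFun_conv_iterate {E : Type*} [NormedAddCommGroup E] [InnerProductSpace ℝ E]
    [MeasurableSpace E] [BorelSpace E] [SecondCountableTopology E]
    (ν : Measure E) [IsProbabilityMeasure ν] (n : ℕ) (t : E) :
    charFun ((fun m : Measure E => m.conv ν)^[n] (Measure.dirac 0)) t = charFun ν t ^ n := by
  induction n with
  | zero => simp
  | succ n ih =>
    have := isProbabilityMeasure_conv_iterate ν n
    rw [Function.iterate_succ_apply', charFun_conv, ih, pow_succ]

theorem rpow_one_div_mul_rpow {β ε : ℝ} (hβ : 0 < β) (hε : 0 < ε) (y : ℝ) :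
    |ε ^ (1 / β) * y| ^ β = ε * |y| ^ β := by
  have hp := Real.rpow_pos_of_pos hε (1 / β)
  rw [abs_mul, abs_of_pos hp, Real.mul_rpow hp.le (abs_nonneg _), ← Real.rpow_mul hε.le,
    one_div_mul_cancel hβ.ne', Real.rpow_one]

/-- The analytic core, used twice: with g = `charFun ν` - 1 and ε = 1/n to build stable laws, and
with g = Ψ and ε = a^d to prove the convergence. -/
theorem tendsto_inv_mul_integral_comp_rpow_mul {X : Type*} [MeasurableSpace X] {m : Measure X}
    {g : ℝ → ℂ} (hg : Continuous g) (hg0 : g 0 = 0) {β C : ℝ} (hβ : 0 < β)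
    (hlim : Tendsto (fun ξ : ℝ => g ξ / ((|ξ| ^ β : ℝ) : ℂ)) (𝓝[≠] 0) (𝓝 ((-C : ℝ) : ℂ)))
    {B : ℝ → ℝ} (hB : ∀ ε : ℝ, 0 < ε → ε ≤ 1 → ∀ y, ‖g (ε ^ (1 / β) * y)‖ ≤ ε * B y)
    {f : X → ℝ} (hf : AEStronglyMeasurable f m) (hBf : Integrable (fun x => B (f x)) m) :
    Tendsto (fun ε : ℝ => ((ε⁻¹ : ℝ) : ℂ) * ∫ x, g (ε ^ (1 / β) * f x) ∂m) (𝓝[>] 0)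
      (𝓝 ((-(C * ∫ x, |f x| ^ β ∂m) : ℝ) : ℂ)) := by
  have hlim' : ((-(C * ∫ x, |f x| ^ β ∂m) : ℝ) : ℂ)
      = ∫ x, ((-(C * |f x| ^ β) : ℝ) : ℂ) ∂m := by
    rw [← integral_const_mul, ← integral_neg]
    exact integral_ofReal.symm
  simp_rw [hlim', ← integral_const_mul]
  have hI : ∀ᶠ ε : ℝ in 𝓝[>] 0, 0 < ε ∧ ε ≤ 1 := Ioc_mem_nhdsGT one_pos
  refine tendsto_integral_filter_of_dominated_convergence (fun x => B (f x)) ?_ ?_ hBf ?_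
  · exact Eventually.of_forall fun ε =>
      (hg.comp_aestronglyMeasurable (hf.const_mul _)).const_mul _
  · filter_upwards [hI] with ε hε
    refine ae_of_all _ fun x => ?_
    rw [norm_mul, Complex.norm_real, norm_inv, Real.norm_of_nonneg hε.1.le,
      inv_mul_le_iff₀ hε.1]
    exact hB ε hε.1 hε.2 _
  · refine ae_of_all _ fun x => ?_
    rcases eq_or_ne (f x) 0 with h0 | h0
    · simp [h0, hg0, Real.zero_rpow hβ.ne']
    have hsc : Tendsto (fun ε : ℝ => ε ^ (1 / β) * f x) (𝓝[>] 0) (𝓝[≠] 0) := by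
      refine tendsto_nhdsWithin_iff.2 ⟨?_, ?_⟩
      · have : Tendsto (fun ε : ℝ => ε ^ (1 / β) * f x) (𝓝 0) (𝓝 ((0 : ℝ) ^ (1 / β) * f x)) :=
          ((Real.continuousAt_rpow_const _ _ (Or.inr (by positivity))).tendsto).mul_const _
        rw [Real.zero_rpow (by positivity), zero_mul] at this
        exact this.mono_left nhdsWithin_le_nhds
      · filter_upwards [hI] with ε hε
        have := Real.rpow_pos_of_pos hε.1 (1 / β)
        exact mul_ne_zero this.ne' h0
    have h1 := (hlim.comp hsc).mul_const (((|f x| ^ β : ℝ) : ℂ))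
    have h2 : ((-C : ℝ) : ℂ) * ((|f x| ^ β : ℝ) : ℂ) = ((-(C * |f x| ^ β) : ℝ) : ℂ) := by
      push_cast; ring
    rw [h2] at h1
    refine h1.congr' ?_
    filter_upwards [hI] with ε hε
    have h3 := rpow_one_div_mul_rpow hβ hε.1 (f x)
    have h4 : ((|f x| ^ β : ℝ) : ℂ) ≠ 0 :=
      Complex.ofReal_ne_zero.2 (Real.rpow_pos_of_pos (abs_pos.2 h0) β).ne'
    have h5 : (ε : ℂ) ≠ 0 := Complex.ofReal_ne_zero.2 hε.1.ne'
    simp only [Function.comp_apply, h3]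
    push_cast at h4 ⊢
    field_simp

/-- A limit theorem with random directions: ν lies in the domain of attraction of a stable law, and
the direction F(x), drawn from m, spreads it over E. -/
theorem exists_charFun_eq_exp_neg_of_isProbabilityMeasure {X E : Type*} [MeasurableSpace X]
    {m : Measure X}
    [IsProbabilityMeasure m] [NormedAddCommGroup E] [InnerProductSpace ℝ E]
    [FiniteDimensional ℝ E] [MeasurableSpace E] [BorelSpace E]
    {ν : Measure ℝ} [IsProbabilityMeasure ν] {β C M : ℝ} (hβ : 0 < β)
    (hM : ∀ ξ, ‖charFun ν ξ - 1‖ ≤ M * |ξ| ^ β)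
    (hlim : Tendsto (fun ξ : ℝ => (charFun ν ξ - 1) / ((|ξ| ^ β : ℝ) : ℂ)) (𝓝[≠] 0)
      (𝓝 ((-C : ℝ) : ℂ)))
    {F : X → E} (hF : AEStronglyMeasurable F m) (hFi : Integrable (fun x => ‖F x‖ ^ β) m) :
    ∃ ρ : Measure E, IsProbabilityMeasure ρ ∧
      ∀ t, charFun ρ t = Complex.exp (-(C * ∫ x, |inner ℝ (F x) t| ^ β ∂m : ℝ)) := by
  have hle : ∀ t x, |inner ℝ (F x) t| ^ β ≤ ‖t‖ ^ β * ‖F x‖ ^ β := fun t x => by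
    rw [← Real.mul_rpow (norm_nonneg _) (norm_nonneg _), mul_comm]
    exact Real.rpow_le_rpow (abs_nonneg _) (abs_real_inner_le_norm _ _) hβ.le
  have hmeas : ∀ t, AEStronglyMeasurable (fun x => (inner ℝ (F x) t : ℝ)) m := fun t =>
    hF.inner aestronglyMeasurable_const
  have hmeasβ : ∀ t, AEStronglyMeasurable (fun x => |(inner ℝ (F x) t : ℝ)| ^ β) m := fun t =>
    ((hmeas t).aemeasurable.abs.pow_const β).aestronglyMeasurable
  have hint : ∀ t, Integrable (fun x => |(inner ℝ (F x) t : ℝ)| ^ β) m := fun t =>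
    (hFi.const_mul (‖t‖ ^ β)).mono' (hmeasβ t) (ae_of_all _ fun x => by
      rw [Real.norm_of_nonneg (by positivity)]; exact hle t x)
  -- Law of n^{-1/β} Y F(x), with Y of law ν independent of x of law m; its n-fold convolution will
  -- converge.
  let κ : ℕ → Measure E := fun n =>
    (ν.prod m).map fun p => (((n : ℝ)⁻¹ ^ (1 / β)) * p.1) • F p.2
  have hκm : ∀ n : ℕ, AEMeasurable (fun p : ℝ × X => (((n : ℝ)⁻¹ ^ (1 / β)) * p.1) • F p.2)
      (ν.prod m) := fun n =>
    (measurable_fst.const_mul _).aemeasurable.smul hF.comp_snd.aemeasurable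
  have hκp : ∀ n, IsProbabilityMeasure (κ n) := fun n => Measure.isProbabilityMeasure_map (hκm n)
  have hκ : ∀ n t, charFun (κ n) t
      = ∫ x, charFun ν ((n : ℝ)⁻¹ ^ (1 / β) * inner ℝ (F x) t) ∂m := by
    intro n t
    rw [charFun_apply, integral_map (hκm n) (by fun_prop), integral_prod_symm]
    · refine integral_congr_ae (ae_of_all _ fun x => ?_)
      simp only [charFun_apply_real, real_inner_smul_left]
      congr 1 with y
      congr 1
      push_cast
      ring
    · refine Integrable.of_bound (C := 1) ?_ (ae_of_all _ fun p => ?_)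
      · exact (by fun_prop : Continuous fun x : E =>
          Complex.exp ((inner ℝ x t : ℝ) * Complex.I)).comp_aestronglyMeasurable
            (hκm n).aestronglyMeasurable
      · rw [Complex.norm_exp_ofReal_mul_I]
  have hpow : ∀ t, Tendsto (fun n : ℕ => (n : ℂ) * (charFun (κ n) t - 1)) atTop
      (𝓝 ((-(C * ∫ x, |inner ℝ (F x) t| ^ β ∂m) : ℝ) : ℂ)) := by
    intro t
    have h1 := tendsto_inv_mul_integral_comp_rpow_mul (m := m) (g := fun ξ => charFun ν ξ - 1)
      (C := C) (B := fun y => M * |y| ^ β) (continuous_charFun.sub continuous_const) (by simp) hβ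
      hlim (fun ε hε _ y => by
        refine (hM _).trans_eq ?_
        rw [rpow_one_div_mul_rpow hβ hε]
        ring) (hmeas t) ((hint t).const_mul M)
    have h2 : Tendsto (fun n : ℕ => (n : ℝ)⁻¹) atTop (𝓝[>] 0) :=
      tendsto_inv_atTop_nhdsGT_zero.comp tendsto_natCast_atTop_atTop
    refine (h1.comp h2).congr fun n => ?_
    simp only [Function.comp_apply, inv_inv, hκ]
    rw [integral_sub _ (integrable_const _)]
    · simp
    · exact Integrable.of_bound (C := 1)
        (continuous_charFun.comp_aestronglyMeasurable ((hmeas t).const_mul _))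
        (ae_of_all _ fun x => norm_charFun_le_one _)
  have hprob := fun n => isProbabilityMeasure_conv_iterate (κ n) n
  refine exists_probabilityMeasure_charFun_eq
    (μ := fun n => (fun m : Measure E => m.conv (κ n))^[n] (Measure.dirac 0)) ?_ fun t => ?_
  · have h0 : Tendsto (fun t : E => ∫ x, |(inner ℝ (F x) t : ℝ)| ^ β ∂m) (𝓝 0) (𝓝 0) := by
      have hb : Tendsto (fun t : E => ‖t‖ ^ β * ∫ x, ‖F x‖ ^ β ∂m) (𝓝 0) (𝓝 0) := by
        have : Continuous fun t : E => ‖t‖ ^ β * ∫ x, ‖F x‖ ^ β ∂m :=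
          (continuous_norm.rpow_const fun _ => Or.inr hβ.le).mul_const _
        simpa [Real.zero_rpow hβ.ne'] using this.tendsto 0
      refine squeeze_zero (fun t => integral_nonneg fun x => by positivity) (fun t => ?_) hb
      rw [← integral_const_mul]
      exact integral_mono (hint t) (hFi.const_mul _) (hle t)
    have hc : Continuous fun r : ℝ => Complex.exp (-(C * r : ℝ)) := by fun_prop
    have h2 := (hc.tendsto 0).comp h0
    simpa [ContinuousAt, Real.zero_rpow hβ.ne', Function.comp_def] using h2
  · have h3 := Complex.tendsto_one_add_pow_exp_of_tendsto (hpow t)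
    simp only [add_sub_cancel, Complex.ofReal_neg] at h3
    simpa only [charFun_conv_iterate] using h3

/-- Reduction to a probability measure p equivalent to m: the density D of m is absorbed by
replacing F with D^{1/β} F. -/
theorem exists_charFun_eq_exp_neg {X E : Type*} [MeasurableSpace X] {m : Measure X}
    [SigmaFinite m] [NormedAddCommGroup E] [InnerProductSpace ℝ E]
    [FiniteDimensional ℝ E] [MeasurableSpace E] [BorelSpace E]
    {ν : Measure ℝ} [IsProbabilityMeasure ν] {β C M : ℝ} (hβ : 0 < β)
    (hM : ∀ ξ, ‖charFun ν ξ - 1‖ ≤ M * |ξ| ^ β)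
    (hlim : Tendsto (fun ξ : ℝ => (charFun ν ξ - 1) / ((|ξ| ^ β : ℝ) : ℂ)) (𝓝[≠] 0)
      (𝓝 ((-C : ℝ) : ℂ)))
    {F : X → E} (hF : AEStronglyMeasurable F m) (hFi : Integrable (fun x => ‖F x‖ ^ β) m) :
    ∃ ρ : Measure E, IsProbabilityMeasure ρ ∧
      ∀ t, charFun ρ t = Complex.exp (-(C * ∫ x, |inner ℝ (F x) t| ^ β ∂m : ℝ)) := by
  rcases eq_or_ne m 0 with rfl | hm
  · exact ⟨Measure.dirac 0, inferInstance, fun t => by simp⟩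
  have : NeZero m := ⟨hm⟩
  obtain ⟨p, hp, hmp, hpm⟩ : ∃ p : Measure X, IsProbabilityMeasure p ∧ m ≪ p ∧ p ≪ m :=
    ⟨m.toFinite, inferInstance, absolutelyContinuous_toFinite m, toFinite_absolutelyContinuous m⟩
  let D : X → ℝ := fun x => (m.rnDeriv p x).toReal
  have hD : Measurable D := (Measure.measurable_rnDeriv m p).ennreal_toReal
  have hD0 : ∀ x, 0 ≤ D x := fun x => ENNReal.toReal_nonneg
  have hDint : ∀ g : X → ℝ, ∫ x, g x ∂m = ∫ x, D x * g x ∂p := fun g =>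
    (integral_rnDeriv_smul hmp).symm
  have hpowD : ∀ x, ∀ y : ℝ, 0 ≤ y → ((D x) ^ (1 / β) * y) ^ β = D x * y ^ β := fun x y hy => by
    rw [Real.mul_rpow (Real.rpow_nonneg (hD0 x) _) hy, ← Real.rpow_mul (hD0 x),
      one_div_mul_cancel hβ.ne', Real.rpow_one]
  obtain ⟨ρ, hρ, hρt⟩ := exists_charFun_eq_exp_neg_of_isProbabilityMeasure (m := p) hβ hM hlim
    (F := fun x => (D x) ^ (1 / β) • F x)
    ((hD.pow_const _).aestronglyMeasurable.smul (hF.mono_ac hpm)) (by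
      have := (integrable_rnDeriv_smul_iff hmp).2 hFi
      refine this.congr (ae_of_all _ fun x => ?_)
      simp only [norm_smul, Real.norm_of_nonneg (Real.rpow_nonneg (hD0 x) _)]
      exact (hpowD x _ (norm_nonneg _)).symm)
  refine ⟨ρ, hρ, fun t => ?_⟩
  rw [hρt, hDint]
  congr 5 with x
  rw [real_inner_smul_left, abs_mul, abs_of_nonneg (Real.rpow_nonneg (hD0 x) _),
    hpowD x _ (abs_nonneg _)]

/-! ### Growth of Lévy exponents -/

theorem re_charFun (ν : Measure ℝ) [IsProbabilityMeasure ν] (t : ℝ) :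
    1 - (charFun ν t).re = ∫ x, (1 - Real.cos (t * x)) ∂ν := by
  have hi : Integrable (fun x : ℝ => Complex.exp (t * x * Complex.I)) ν :=
    Integrable.of_bound (C := 1) (by fun_prop) (ae_of_all _ fun x => by
      rw [← Complex.ofReal_mul, Complex.norm_exp_ofReal_mul_I])
  have h1 : (charFun ν t).re = ∫ x, Real.cos (t * x) ∂ν := by
    rw [charFun_apply_real, ← RCLike.re_eq_complex_re, ← integral_re hi]
    congr 1 with x
    rw [RCLike.re_eq_complex_re, ← Complex.ofReal_mul, Complex.exp_ofReal_mul_I_re]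
  have h2 : Integrable (fun x : ℝ => Real.cos (t * x)) ν :=
    Integrable.of_bound (C := 1) (by fun_prop) (ae_of_all _ fun x => Real.abs_cos_le_one _)
  rw [h1, integral_sub (integrable_const _) h2]
  simp

theorem im_charFun (ν : Measure ℝ) [IsProbabilityMeasure ν] (t : ℝ) :
    (charFun ν t).im = ∫ x, Real.sin (t * x) ∂ν := by
  have hi : Integrable (fun x : ℝ => Complex.exp (t * x * Complex.I)) ν :=
    Integrable.of_bound (C := 1) (by fun_prop) (ae_of_all _ fun x => by
      rw [← Complex.ofReal_mul, Complex.norm_exp_ofReal_mul_I])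
  rw [charFun_apply_real, ← RCLike.im_eq_complex_im, ← integral_im hi]
  congr 1 with x
  rw [RCLike.im_eq_complex_im, ← Complex.ofReal_mul, Complex.exp_ofReal_mul_I_im]

theorem integrable_one_sub_cos (ν : Measure ℝ) [IsProbabilityMeasure ν] (t : ℝ) :
    Integrable (fun x : ℝ => 1 - Real.cos (t * x)) ν :=
  (integrable_const _).sub
    (Integrable.of_bound (C := 1) (by fun_prop) (ae_of_all _ fun x => Real.abs_cos_le_one _))

theorem one_sub_re_charFun_two_mul_le (ν : Measure ℝ) [IsProbabilityMeasure ν] (t : ℝ) :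
    1 - (charFun ν (2 * t)).re ≤ 4 * (1 - (charFun ν t).re) := by
  rw [re_charFun, re_charFun, ← integral_const_mul]
  refine integral_mono (integrable_one_sub_cos ν _) ((integrable_one_sub_cos ν t).const_mul 4)
    fun x => ?_
  have : Real.cos (2 * t * x) = 2 * Real.cos (t * x) ^ 2 - 1 := by
    rw [mul_assoc, Real.cos_two_mul]
  simp only [this]
  nlinarith [sq_nonneg (1 - Real.cos (t * x))]

/-- Subtracting twice the value at t cancels the drift, which is linear in t; the remainder -2 sin θ
(1 - cos θ) is controlled by the real part. -/
theorem abs_im_charFun_two_mul_sub_le (ν : Measure ℝ) [IsProbabilityMeasure ν] (t : ℝ) :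
    |(charFun ν (2 * t)).im - 2 * (charFun ν t).im| ≤ 2 * (1 - (charFun ν t).re) := by
  have hs : ∀ t : ℝ, Integrable (fun x : ℝ => Real.sin (t * x)) ν := fun t =>
    Integrable.of_bound (C := 1) (by fun_prop) (ae_of_all _ fun x => Real.abs_sin_le_one _)
  rw [im_charFun, im_charFun, re_charFun, ← integral_const_mul, ← integral_const_mul,
    ← integral_sub (hs _) ((hs t).const_mul 2)]
  refine (abs_integral_le_integral_abs).trans (integral_mono
    ((hs _).sub ((hs t).const_mul 2)).abs ((integrable_one_sub_cos ν t).const_mul 2) fun x => ?_)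
  have h1 : Real.sin (2 * t * x) - 2 * Real.sin (t * x)
      = -(2 * Real.sin (t * x) * (1 - Real.cos (t * x))) := by
    rw [mul_assoc, Real.sin_two_mul]; ring
  have h2 := Real.abs_sin_le_one (t * x)
  have h3 : 0 ≤ 1 - Real.cos (t * x) := by linarith [Real.cos_le_one (t * x)]
  simp only [h1, abs_neg, abs_mul, abs_of_nonneg h3, abs_two]
  nlinarith

/-- The quotient of the root's characteristic function by exp(Ψ/n) is continuous, takes values in
the finite set of n-th roots of unity, and equals 1 at 0; connectedness of ℝ makes it constant. -/
theorem IsLevyExponentOf.exists_charFun_eq_exp_div {Ψ : ℝ → ℂ} {μ : Measure ℝ}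
    (h : IsLevyExponentOf Ψ μ) {n : ℕ} (hn : 0 < n) :
    ∃ ν : Measure ℝ, IsProbabilityMeasure ν ∧ ∀ ξ, charFun ν ξ = Complex.exp (Ψ ξ / n) := by
  obtain ⟨ν, hν, hμ⟩ := h.infinitelyDivisible n hn
  have hn0 : (n : ℂ) ≠ 0 := Nat.cast_ne_zero.2 hn.ne'
  refine ⟨ν, hν, fun ξ => ?_⟩
  let q : ℝ → ℂ := fun ξ => charFun ν ξ * Complex.exp (-(Ψ ξ / n))
  have hq : ∀ ξ, q ξ ∈ {z : ℂ | z ^ n = 1} := fun ξ => by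
    have h1 : charFun ν ξ ^ n = Complex.exp (Ψ ξ) := by
      rw [← charFun_conv_iterate, hμ, h.charFun_eq]
    simp only [q, Set.mem_ofPred_eq, mul_pow, h1, ← Complex.exp_nat_mul, ← Complex.exp_add]
    rw [mul_neg, mul_div_cancel₀ _ hn0, add_neg_cancel, Complex.exp_zero]
  have hfin : {z : ℂ | z ^ n = 1}.Finite := by
    refine (Polynomial.nthRoots n (1 : ℂ)).toFinset.finite_toSet.subset fun z hz => ?_
    simpa [Polynomial.mem_nthRoots hn] using hz
  have hqc : Continuous q := continuous_charFun.mul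
    (Complex.continuous_exp.comp (h.continuous.div_const _).neg)
  have hconst : q ξ = q 0 :=

    isPreconnected_univ.constant_of_mapsTo hfin.isDiscrete hqc.continuousOn
      (fun ξ _ => hq ξ) (Set.mem_univ _) (Set.mem_univ _)
  have h0 : q 0 = 1 := by simp [q, h.map_zero]
  rw [h0] at hconst
  simp only [q, Complex.exp_neg] at hconst
  rwa [mul_inv_eq_one₀ (Complex.exp_ne_zero _)] at hconst

theorem tendsto_nat_mul_exp_div_sub_one (z : ℂ) :
    Tendsto (fun n : ℕ => (n : ℂ) * (Complex.exp (z / n) - 1)) atTop (𝓝 z) := by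
  rcases eq_or_ne z 0 with rfl | hz
  · simp
  have h1 : Tendsto (fun t : ℂ => t⁻¹ * (Complex.exp t - 1)) (𝓝[≠] 0) (𝓝 1) := by
    simpa using (Complex.hasDerivAt_exp 0).tendsto_slope_zero
  have h2 : Tendsto (fun n : ℕ => z / n) atTop (𝓝[≠] 0) := by
    refine tendsto_nhdsWithin_iff.2 ⟨tendsto_const_div_atTop_nhds_zero_nat z, ?_⟩
    filter_upwards [eventually_gt_atTop 0] with n hn
    exact div_ne_zero hz (Nat.cast_ne_zero.2 hn.ne')
  have h3 := (h1.comp h2).const_mul z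
  rw [mul_one] at h3
  refine h3.congr' ?_
  filter_upwards [eventually_gt_atTop 0] with n hn
  have : (n : ℂ) ≠ 0 := Nat.cast_ne_zero.2 hn.ne'
  simp only [Function.comp_apply]
  field_simp

/-- Doubling inequalities for a Lévy exponent. -/
theorem IsLevyExponentOf.doubling {Ψ : ℝ → ℂ} {μ : Measure ℝ}
    (h : IsLevyExponentOf Ψ μ) (ξ : ℝ) :
    0 ≤ -(Ψ ξ).re ∧ -(Ψ (2 * ξ)).re ≤ 4 * -(Ψ ξ).re ∧
      |(Ψ (2 * ξ)).im - 2 * (Ψ ξ).im| ≤ 2 * -(Ψ ξ).re := by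
  choose! ν hν hνξ using fun (n : ℕ) (hn : 0 < n) => h.exists_charFun_eq_exp_div hn
  -- Ψ is the limit of n(`charFun (ν n)` - 1). The doubling inequalities are homogeneous in
  -- `charFun` - 1, so they pass to Ψ.
  have hre : ∀ ξ, Tendsto (fun n : ℕ => (n : ℝ) * (1 - (charFun (ν n) ξ).re)) atTop
      (𝓝 (-(Ψ ξ).re)) := fun ξ => by
    have h1 := ((Complex.continuous_re.tendsto _).comp
      (tendsto_nat_mul_exp_div_sub_one (Ψ ξ))).neg
    refine h1.congr' ?_
    filter_upwards [eventually_gt_atTop 0] with n hn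
    simp only [Function.comp_apply, hνξ n hn, Complex.mul_re, Complex.natCast_re,
      Complex.natCast_im, Complex.sub_re, Complex.one_re]
    ring
  have him : ∀ ξ, Tendsto (fun n : ℕ => (n : ℝ) * (charFun (ν n) ξ).im) atTop
      (𝓝 (Ψ ξ).im) := fun ξ => by
    have h1 := (Complex.continuous_im.tendsto _).comp (tendsto_nat_mul_exp_div_sub_one (Ψ ξ))
    refine h1.congr' ?_
    filter_upwards [eventually_gt_atTop 0] with n hn
    simp [hνξ n hn]
  refine ⟨ge_of_tendsto (hre ξ) ?_, le_of_tendsto_of_tendsto (hre (2 * ξ)) ((hre ξ).const_mul 4) ?_,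
    le_of_tendsto_of_tendsto ((him (2 * ξ)).sub ((him ξ).const_mul 2)).abs
      ((hre ξ).const_mul 2) ?_⟩
  · filter_upwards [eventually_gt_atTop 0] with n hn
    have := hν n hn
    have h2 := (Complex.re_le_norm _).trans (norm_charFun_le_one (μ := ν n) ξ)
    exact mul_nonneg n.cast_nonneg (by linarith)
  · filter_upwards [eventually_gt_atTop 0] with n hn
    have := hν n hn
    have h2 := mul_le_mul_of_nonneg_left (one_sub_re_charFun_two_mul_le (ν n) ξ)
      (Nat.cast_nonneg (α := ℝ) n)
    linarith
  · filter_upwards [eventually_gt_atTop 0] with n hn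
    have := hν n hn
    have h2 := mul_le_mul_of_nonneg_left (abs_im_charFun_two_mul_sub_le (ν n) ξ)
      (Nat.cast_nonneg (α := ℝ) n)
    rw [← abs_of_nonneg (Nat.cast_nonneg (α := ℝ) n), ← abs_mul, abs_of_nonneg
      (Nat.cast_nonneg (α := ℝ) n)] at h2
    calc _ = |(n : ℝ) * ((charFun (ν n) (2 * ξ)).im - 2 * (charFun (ν n) ξ).im)| := by ring_nf
      _ ≤ _ := h2.trans_eq (by ring)

/-- A Lévy exponent grows at most quadratically at infinity. -/
theorem IsLevyExponentOf.exists_norm_le_mul_sq {Ψ : ℝ → ℂ} {μ : Measure ℝ}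
    (h : IsLevyExponentOf Ψ μ) {δ : ℝ} (hδ : 0 < δ) :
    ∃ M : ℝ, 0 ≤ M ∧ ∀ ξ, δ ≤ |ξ| → ‖Ψ ξ‖ ≤ M * ξ ^ 2 := by
  obtain ⟨A, hA⟩ := (isCompact_Icc (a := -(2 * δ)) (b := 2 * δ)).exists_bound_of_continuousOn
    h.continuous.continuousOn
  have hA0 : 0 ≤ A := (norm_nonneg _).trans (hA 0 ⟨by linarith, by linarith⟩)
  set K := A / δ ^ 2 with hK
  have hK0 : 0 ≤ K := by positivity
  -- Induction over dyadic shells with one constant K. Halving ξ divides ξ² by 4, which pays for the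
  -- factor 4 in the real part and for the 2 + 2 in the imaginary part.
  have key : ∀ k : ℕ, ∀ ξ, δ ≤ |ξ| → |ξ| ≤ 2 ^ (k + 1) * δ →
      -(Ψ ξ).re ≤ K * ξ ^ 2 ∧ |(Ψ ξ).im| ≤ K * ξ ^ 2 := by
    intro k
    induction k with
    | zero =>
      intro ξ h1 h2
      have h3 := hA ξ (abs_le.1 (by simpa using h2))
      have h4 : A ≤ K * ξ ^ 2 := by
        rw [hK, ← sq_abs ξ, div_mul_eq_mul_div, le_div_iff₀ (by positivity)]
        gcongr
      exact ⟨(neg_le_abs _).trans ((Complex.abs_re_le_norm _).trans (h3.trans h4)),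
        (Complex.abs_im_le_norm _).trans (h3.trans h4)⟩
    | succ k ih =>
      intro ξ h1 h2
      rcases le_or_gt |ξ| (2 ^ (k + 1) * δ) with h3 | h3
      · exact ih ξ h1 h3
      have h4 : |ξ / 2| = |ξ| / 2 := by rw [abs_div, abs_two]
      have h5 : 2 * δ ≤ 2 ^ (k + 1) * δ := by
        rw [pow_succ']
        have := one_le_pow₀ (one_le_two (α := ℝ)) (n := k)
        nlinarith
      have h6 : |ξ| ≤ 2 * (2 ^ (k + 1) * δ) := by rw [← mul_assoc, ← pow_succ']; exact h2
      obtain ⟨i1, i2⟩ := ih (ξ / 2) (by rw [h4]; linarith) (by rw [h4]; linarith)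
      obtain ⟨d0, d1, d2⟩ := h.doubling (ξ / 2)
      rw [mul_div_cancel₀ ξ two_ne_zero] at d1 d2
      refine ⟨by nlinarith, ?_⟩
      have h7 := abs_sub_abs_le_abs_sub (Ψ ξ).im (2 * (Ψ (ξ / 2)).im)
      rw [abs_mul, abs_two] at h7
      nlinarith
  refine ⟨2 * K, by positivity, fun ξ hξ => ?_⟩
  obtain ⟨k, hk⟩ := pow_unbounded_of_one_lt (|ξ| / δ) (one_lt_two (α := ℝ))
  have hk' : |ξ| ≤ 2 ^ (k + 1) * δ := by
    rw [← div_le_iff₀ hδ]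
    exact hk.le.trans (pow_le_pow_right₀ one_le_two k.le_succ)
  obtain ⟨h1, h2⟩ := key k ξ hξ hk'
  have h3 := (h.doubling ξ).1
  refine (Complex.norm_le_abs_re_add_abs_im _).trans ?_
  rw [← abs_neg, abs_of_nonneg h3]
  linarith

/-! ### Characteristic functionals and laws of linear processes -/

theorem coeFn_map_sum {X V : Type*} [MeasurableSpace X] {m : Measure X} [AddCommGroup V]
    [Module ℝ V] (A : V →ₗ[ℝ] (X →ₘ[m] ℝ)) {ι : Type*} (S : Finset ι) (t : ι → ℝ) (ψ : ι → V) :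
    (A (∑ k ∈ S, t k • ψ k) : X → ℝ) =ᵐ[m] fun x => ∑ k ∈ S, t k * A (ψ k) x := by
  classical
  induction S using Finset.induction_on with
  | empty =>
    simp only [Finset.sum_empty, map_zero]
    exact AEEqFun.coeFn_zero
  | insert a S ha ih =>
    simp only [Finset.sum_insert ha, map_add, map_smul]
    filter_upwards [AEEqFun.coeFn_add (t a • A (ψ a)) (A (∑ k ∈ S, t k • ψ k)),
      AEEqFun.coeFn_smul (t a) (A (ψ a)), ih] with x h1 h2 h3
    rw [h1, Pi.add_apply, h2, h3, Pi.smul_apply, smul_eq_mul]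

/-- By linearity, the characteristic functional contains the characteristic functions of all
marginals. -/
theorem charFunctional_sum {Ω V : Type*} [MeasurableSpace Ω] {P : Measure Ω} [AddCommGroup V]
    [Module ℝ V] (s : V →ₗ[ℝ] (Ω →ₘ[P] ℝ)) {ι : Type*} [Fintype ι] (t : ι → ℝ) (ψ : ι → V) :
    charFunctional s (∑ k, t k • ψ k)
      = ∫ ω, Complex.exp (Complex.I * ((∑ k, t k * s (ψ k) ω : ℝ) : ℂ)) ∂P := by
  refine integral_congr_ae ?_
  filter_upwards [coeFn_map_sum s Finset.univ t ψ] with ω hω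
  rw [hω]

theorem aemeasurable_pi_process {Ω V : Type*} [MeasurableSpace Ω] {P : Measure Ω}
    [AddCommGroup V] [Module ℝ V] (s : V →ₗ[ℝ] (Ω →ₘ[P] ℝ)) {ι : Type*} [Countable ι]
    (ψ : ι → V) : AEMeasurable (fun ω k => s (ψ k) ω) P :=
  aemeasurable_pi_lambda _ fun k => (s (ψ k)).aemeasurable

/-- `charFun` is taken on an inner product space, so marginals on `ι → ℝ` are carried to
`EuclideanSpace`. -/
theorem charFun_map_toLp {Ω : Type*} [MeasurableSpace Ω] {P : Measure Ω} {ι : Type*} [Fintype ι]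
    {Y : Ω → ι → ℝ} (hY : AEMeasurable Y P) (t : EuclideanSpace ℝ ι) :
    charFun ((P.map Y).map (WithLp.toLp 2)) t
      = ∫ ω, Complex.exp (Complex.I * ((∑ k, t k * Y ω k : ℝ) : ℂ)) ∂P := by
  have hm : Measurable (WithLp.toLp 2 : (ι → ℝ) → EuclideanSpace ℝ ι) := by fun_prop
  rw [charFun_apply, integral_map hm.aemeasurable (by fun_prop), integral_map hY (by fun_prop)]
  congr 1 with ω
  rw [mul_comm]
  simp [PiLp.inner_apply]

theorem map_toLp_injective {ι : Type*} [Fintype ι] {μ ν : Measure (ι → ℝ)}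
    (h : μ.map (WithLp.toLp 2) = ν.map (WithLp.toLp 2)) : μ = ν := by
  have hm : Measurable (WithLp.toLp 2 : (ι → ℝ) → EuclideanSpace ℝ ι) := by fun_prop
  have hm' : Measurable (WithLp.ofLp : EuclideanSpace ℝ ι → (ι → ℝ)) := by fun_prop
  have := congrArg (Measure.map (WithLp.ofLp : EuclideanSpace ℝ ι → (ι → ℝ))) h
  rw [Measure.map_map hm' hm, Measure.map_map hm' hm] at this
  simpa [Function.comp_def] using this

theorem map_eq_of_integral_exp_eq {Ω Ω' : Type*} [MeasurableSpace Ω] [MeasurableSpace Ω']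
    {P : Measure Ω} {P' : Measure Ω'} [IsProbabilityMeasure P] [IsProbabilityMeasure P']
    {ι : Type*} [Fintype ι] {Y : Ω → ι → ℝ} {Z : Ω' → ι → ℝ} (hY : AEMeasurable Y P)
    (hZ : AEMeasurable Z P')
    (h : ∀ t : ι → ℝ, ∫ ω, Complex.exp (Complex.I * ((∑ k, t k * Y ω k : ℝ) : ℂ)) ∂P
      = ∫ ω, Complex.exp (Complex.I * ((∑ k, t k * Z ω k : ℝ) : ℂ)) ∂P') :
    P.map Y = P'.map Z := by
  refine map_toLp_injective (Measure.ext_of_charFun (funext fun t => ?_))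
  rw [charFun_map_toLp hY, charFun_map_toLp hZ, h]

theorem equalInLaw_of_charFunctional_eq {d : ℕ} {Ω Ω' : Type*} [MeasurableSpace Ω]
    [MeasurableSpace Ω'] {P : Measure Ω} {P' : Measure Ω'} [IsProbabilityMeasure P]
    [IsProbabilityMeasure P'] {s : TestFun d →ₗ[ℝ] (Ω →ₘ[P] ℝ)}
    {r : TestFun d →ₗ[ℝ] (Ω' →ₘ[P'] ℝ)} (h : ∀ φ, charFunctional s φ = charFunctional r φ) :
    EqualInLaw s r := fun N φ =>
  map_eq_of_integral_exp_eq (aemeasurable_pi_process s φ) (aemeasurable_pi_process r φ) fun t => by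
    rw [← charFunctional_sum, ← charFunctional_sum, h]

theorem tendstoInDistribution_of_integral_exp {Ω Ω' κ : Type*} [MeasurableSpace Ω]
    [MeasurableSpace Ω'] {P : Measure Ω} {P' : Measure Ω'} [IsProbabilityMeasure P]
    [IsProbabilityMeasure P'] {ι : Type*} [Fintype ι] {l : Filter κ} [l.IsCountablyGenerated]
    {Y : κ → Ω → ι → ℝ} {Z : Ω' → ι → ℝ}
    (hY : ∀ i, AEMeasurable (Y i) P) (hZ : AEMeasurable Z P')
    (h : ∀ t : ι → ℝ, Tendsto
      (fun i => ∫ ω, Complex.exp (Complex.I * ((∑ k, t k * Y i ω k : ℝ) : ℂ)) ∂P) l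
      (𝓝 (∫ ω, Complex.exp (Complex.I * ((∑ k, t k * Z ω k : ℝ) : ℂ)) ∂P'))) :
    TendstoInDistribution Y l Z (fun _ => P) P' := by
  have hm : Measurable (WithLp.toLp 2 : (ι → ℝ) → EuclideanSpace ℝ ι) := by fun_prop
  have hc : Continuous (WithLp.ofLp : EuclideanSpace ℝ ι → (ι → ℝ)) := by fun_prop
  have key : TendstoInDistribution (fun i ω => (WithLp.toLp 2 (Y i ω) : EuclideanSpace ℝ ι)) l
      (fun ω => WithLp.toLp 2 (Z ω)) (fun _ => P) P' := by
    refine ⟨fun i => hm.comp_aemeasurable (hY i), hm.comp_aemeasurable hZ, ?_⟩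
    -- The continuity theorem is applied along sequences, which suffice for a countably generated
    -- filter.
    refine tendsto_of_seq_tendsto fun u hu => ?_
    refine ProbabilityMeasure.tendsto_of_tendsto_charFun fun t => ?_
    have h1 : ∀ i, charFun (P.map fun ω => (WithLp.toLp 2 (Y i ω) : EuclideanSpace ℝ ι)) t
        = ∫ ω, Complex.exp (Complex.I * ((∑ k, t k * Y i ω k : ℝ) : ℂ)) ∂P := fun i => by
      rw [← charFun_map_toLp (hY i), AEMeasurable.map_map_of_aemeasurable hm.aemeasurable (hY i)]
      rfl
    have h2 : charFun (P'.map fun ω => (WithLp.toLp 2 (Z ω) : EuclideanSpace ℝ ι)) t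
        = ∫ ω, Complex.exp (Complex.I * ((∑ k, t k * Z ω k : ℝ) : ℂ)) ∂P' := by
      rw [← charFun_map_toLp hZ, AEMeasurable.map_map_of_aemeasurable hm.aemeasurable hZ]
      rfl
    have h3 := (h t).comp hu
    rw [← h2] at h3
    exact h3.congr fun n => (h1 (u n)).symm
  exact key.continuous_comp hc

theorem convergesInLaw_of_charFunctional {d : ℕ} {Ω Ω' κ : Type*} [MeasurableSpace Ω]
    [MeasurableSpace Ω'] {P : Measure Ω} {P' : Measure Ω'} [IsProbabilityMeasure P]
    [IsProbabilityMeasure P'] {l : Filter κ} [l.IsCountablyGenerated]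
    {s : κ → TestFun d →ₗ[ℝ] (Ω →ₘ[P] ℝ)}
    {r : TestFun d →ₗ[ℝ] (Ω' →ₘ[P'] ℝ)}
    (h : ∀ φ, Tendsto (fun i => charFunctional (s i) φ) l (𝓝 (charFunctional r φ))) :
    ConvergesInLaw l s r := fun N φ =>
  tendstoInDistribution_of_integral_exp (fun i => aemeasurable_pi_process (s i) φ)
    (aemeasurable_pi_process r φ) fun t => by
      simp_rw [← charFunctional_sum]
      exact h _

theorem charFun_map_eq_integral {Ω : Type*} [MeasurableSpace Ω] {P : Measure Ω} {Y : Ω → ℝ}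
    (hY : AEMeasurable Y P) (t : ℝ) :
    charFun (P.map Y) t = ∫ ω, Complex.exp (Complex.I * ((t * Y ω : ℝ) : ℂ)) ∂P := by
  rw [charFun_apply_real, integral_map hY (by fun_prop)]
  congr 1 with ω
  push_cast
  ring_nf

theorem ae_eq_zero_of_integral_exp_eq_one {Ω : Type*} [MeasurableSpace Ω] {P : Measure Ω}
    [IsProbabilityMeasure P] {Y : Ω → ℝ} (hY : AEMeasurable Y P)
    (h : ∀ t : ℝ, ∫ ω, Complex.exp (Complex.I * ((t * Y ω : ℝ) : ℂ)) ∂P = 1) :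
    Y =ᵐ[P] 0 := by
  have hp := Measure.isProbabilityMeasure_map hY
  have h1 : P.map Y = Measure.dirac 0 := Measure.ext_of_charFun (funext fun t => by
    rw [charFun_map_eq_integral hY, h]; simp)
  refine ae_of_ae_map hY (p := fun y => y = 0) ?_
  rw [h1, ae_dirac_eq]
  exact rfl

theorem charFunctional_smul {Ω V : Type*} [MeasurableSpace Ω] {P : Measure Ω} [AddCommGroup V]
    [Module ℝ V] (s : V →ₗ[ℝ] (Ω →ₘ[P] ℝ)) (t : ℝ) (ψ : V) :
    charFunctional s (t • ψ) = charFun (P.map (s ψ)) t := by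
  rw [charFun_map_eq_integral (s ψ).aemeasurable]
  refine integral_congr_ae ?_
  filter_upwards [AEEqFun.coeFn_smul t (s ψ)] with ω hω
  rw [map_smul, hω, Pi.smul_apply, smul_eq_mul]

/-- The tail of ⟨s, uₙ - φ⟩ is bounded by an average of 1 - `charFun` over a fixed interval, which
vanishes by dominated convergence. -/
theorem isGeneralizedProcess_of_charFunctional {d : ℕ} {Ω : Type*} [MeasurableSpace Ω]
    {P : Measure Ω} [IsProbabilityMeasure P] {s : TestFun d →ₗ[ℝ] (Ω →ₘ[P] ℝ)}
    (h : ∀ (u : ℕ → TestFun d) (φ : TestFun d), Tendsto u atTop (𝓝 φ) →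
      ∀ t : ℝ, Tendsto (fun n => charFunctional s (t • (u n - φ))) atTop (𝓝 1)) :
    IsGeneralizedProcess P s := by
  intro u φ hu
  rw [tendstoInMeasure_iff_measureReal_norm]
  intro ε hε
  have hp : ∀ n, IsProbabilityMeasure (P.map (s (u n - φ))) := fun n =>
    Measure.isProbabilityMeasure_map (s (u n - φ)).aemeasurable
  -- The tail bound concerns a strict inequality; halving ε makes room for the event ε ≤ |·|.
  have hr : 0 < ε / 2 := by positivity
  have hbound : ∀ n, P.real {ω | ε ≤ ‖s (u n) ω - s φ ω‖} ≤
      2⁻¹ * (ε / 2) * ‖∫ t in (-2 * (ε / 2)⁻¹)..(2 * (ε / 2)⁻¹),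
        (1 - charFun (P.map (s (u n - φ))) t)‖ := by
    intro n
    refine le_trans ?_ (measureReal_abs_gt_le_integral_charFun (μ := P.map (s (u n - φ))) hr)
    rw [map_measureReal_apply_of_aemeasurable (s (u n - φ)).aemeasurable
      (measurableSet_lt measurable_const (by fun_prop))]
    refine ENNReal.toReal_mono (measure_ne_top _ _) (measure_mono_ae ?_)
    filter_upwards [AEEqFun.coeFn_sub (s (u n)) (s φ)] with ω hω hmem
    have h1 : ε ≤ ‖s (u n) ω - s φ ω‖ := hmem
    change ε / 2 < |s (u n - φ) ω|
    rw [map_sub, hω, Pi.sub_apply, ← Real.norm_eq_abs]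
    linarith
  have hlim : Tendsto (fun n => 2⁻¹ * (ε / 2) * ‖∫ t in (-2 * (ε / 2)⁻¹)..(2 * (ε / 2)⁻¹),
        (1 - charFun (P.map (s (u n - φ))) t)‖) atTop (𝓝 0) := by
    have h1 : Tendsto (fun n => ∫ t in (-2 * (ε / 2)⁻¹)..(2 * (ε / 2)⁻¹),
        (1 - charFun (P.map (s (u n - φ))) t)) atTop
        (𝓝 (∫ _ in (-2 * (ε / 2)⁻¹)..(2 * (ε / 2)⁻¹), (0 : ℂ))) := by
      refine intervalIntegral.tendsto_integral_filter_of_dominated_convergence (fun _ => 2)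
        (Eventually.of_forall fun n => ?_) (Eventually.of_forall fun n => ?_)
        intervalIntegrable_const (ae_of_all _ fun t _ => ?_)
      · exact (continuous_const.sub continuous_charFun).aestronglyMeasurable
      · exact ae_of_all _ fun t _ => norm_one_sub_charFun_le_two
      · simp_rw [← charFunctional_smul]
        simpa using (tendsto_const_nhds (x := (1 : ℂ))).sub (h u φ hu t)
    simpa using (h1.norm.const_mul (2⁻¹ * (ε / 2)))
  exact squeeze_zero (fun n => measureReal_nonneg) hbound hlim

/-! ### Existence of stable processes -/

theorem memLp_ofReal_iff_integrable_abs_rpow {X : Type*} [MeasurableSpace X] {m : Measure X}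
    {f : X → ℝ} (hf : AEStronglyMeasurable f m) {β : ℝ} (hβ : 0 < β) :
    MemLp f (ENNReal.ofReal β) m ↔ Integrable (fun x => |f x| ^ β) m := by
  rw [← integrable_norm_rpow_iff hf (by simpa using hβ) ENNReal.ofReal_ne_top,
    ENNReal.toReal_ofReal hβ.le]
  rfl

/-- A family of finite-dimensional laws with characteristic functions given by a functional `Φ` is
the family of marginals of a linear process with characteristic functional `Φ`. -/
theorem exists_process_of_finite_marginals {V : Type*} [AddCommGroup V] [Module ℝ V]
    {Φ : V → ℂ} (hΦ0 : Φ 0 = 1)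
    (hΦ : ∀ J : Finset V, ∃ ρ : Measure (J → ℝ), IsProbabilityMeasure ρ ∧ ∀ t : J → ℝ,
      ∫ x, Complex.exp (Complex.I * ((∑ j, t j * x j : ℝ) : ℂ)) ∂ρ = Φ (∑ j, t j • (j : V))) :
    ∃ (Q : Measure (V → ℝ)) (_ : IsProbabilityMeasure Q) (r : V →ₗ[ℝ] ((V → ℝ) →ₘ[Q] ℝ)),
      ∀ ψ, charFunctional r ψ = Φ ψ := by
  choose ρ hρ hρt using hΦ
  have hproj : IsProjectiveMeasureFamily (α := fun _ : V => ℝ) ρ := by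
    intro I J hJI
    have hm : Measurable (Finset.restrict₂ (π := fun _ : V => ℝ) hJI) :=
      Finset.measurable_restrict₂ hJI
    rw [← Measure.map_id (μ := ρ J)]
    refine map_eq_of_integral_exp_eq aemeasurable_id hm.aemeasurable fun t => ?_
    let e : J → I := fun j => ⟨j, hJI j.2⟩
    have he : Function.Injective e := fun a b hab =>
      Subtype.ext (congrArg (fun z : I => (z : V)) hab)
    -- Extending the frequencies by zero leaves both ∑ t x and the vector ∑ t ψ unchanged, which
    -- gives consistency.
    let t' : I → ℝ := Function.extend e t 0
    have ht' : ∀ i ∉ Set.range e, t' i = 0 := fun i hi => by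
      simp only [t']
      rw [Function.extend_apply' _ _ _ (by simpa using hi)]
      rfl
    have h1 : ∀ x : I → ℝ, ∑ j, t j * Finset.restrict₂ (π := fun _ : V => ℝ) hJI x j
        = ∑ i, t' i * x i := fun x =>
      Fintype.sum_of_injective e he _ _ (fun i hi => by rw [ht' i hi, zero_mul]) fun j => by
        simp only [t', he.extend_apply]; rfl
    have h2 : ∑ j, t j • (j : V) = ∑ i, t' i • (i : V) :=
      Fintype.sum_of_injective e he _ _ (fun i hi => by rw [ht' i hi, zero_smul]) fun j => by
        simp only [t', he.extend_apply, e]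
    simp only [id_eq, h1]
    rw [hρt, hρt, h2]
  obtain ⟨Q, hQ⟩ := exists_isProjectiveLimit hproj
  have hQp : IsProbabilityMeasure Q := hQ.isProbabilityMeasure
  have hlin : ∀ l : V →₀ ℝ, ∫ ω, Complex.exp
      (Complex.I * ((Finsupp.linearCombination ℝ ω l : ℝ) : ℂ)) ∂Q
      = Φ (Finsupp.linearCombination ℝ id l) := by
    intro l
    have h1 := hρt l.support fun j => l j
    rw [← hQ l.support, integral_map (Finset.measurable_restrict _).aemeasurable
      (Continuous.aestronglyMeasurable (by fun_prop))] at h1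
    simp only [Finset.restrict] at h1
    rw [Finsupp.linearCombination_apply, Finsupp.sum, ← Finset.sum_coe_sort]
    simp only [id_eq]
    rw [← h1]
    congr 1 with ω
    rw [Finsupp.linearCombination_apply, Finsupp.sum, ← Finset.sum_coe_sort]
    simp only [smul_eq_mul]
  have hm : ∀ ψ : V, Measurable fun ω : V → ℝ => ω ψ := fun ψ => measurable_pi_apply ψ
  -- Coordinates on `V → ℝ` are not linear in ψ. A formal combination that vanishes in V, however,
  -- has characteristic function Φ(0) = 1, hence is almost surely zero; this is linearity modulo
  -- null sets.
  have hzero : ∀ l : V →₀ ℝ, Finsupp.linearCombination ℝ (id : V → V) l = 0 →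
      (fun ω : V → ℝ => Finsupp.linearCombination ℝ ω l) =ᵐ[Q] 0 := by
    intro l hl
    refine ae_eq_zero_of_integral_exp_eq_one ?_ fun t => ?_
    · simp only [Finsupp.linearCombination_apply, Finsupp.sum, smul_eq_mul]
      exact (Finset.measurable_fun_sum _ fun v _ => (hm v).const_mul _).aemeasurable
    · have := hlin (t • l)
      simpa [map_smul, hl, hΦ0] using this
  let r : V →ₗ[ℝ] ((V → ℝ) →ₘ[Q] ℝ) :=
    { toFun := fun ψ => AEEqFun.mk (fun ω => ω ψ) (hm ψ).aestronglyMeasurable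
      map_add' := fun u v => by
        rw [AEEqFun.mk_add_mk, AEEqFun.mk_eq_mk]
        filter_upwards [hzero (Finsupp.single (u + v) 1 - Finsupp.single u 1
          - Finsupp.single v 1) (by simp)] with ω hω
        simp only [map_sub, Finsupp.linearCombination_single, one_smul, Pi.zero_apply] at hω
        simp only [Pi.add_apply]
        linarith
      map_smul' := fun c u => by
        rw [RingHom.id_apply, AEEqFun.smul_mk, AEEqFun.mk_eq_mk]
        filter_upwards [hzero (Finsupp.single (c • u) 1 - Finsupp.single u c) (by simp)] with ω hω
        simp only [map_sub, Finsupp.linearCombination_single, Pi.zero_apply,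
          smul_eq_mul] at hω
        simp only [Pi.smul_apply, smul_eq_mul]
        linarith }
  refine ⟨Q, hQp, r, fun ψ => ?_⟩
  have h1 := hlin (Finsupp.single ψ 1)
  simp only [Finsupp.linearCombination_single, one_smul, id_eq] at h1
  rw [← h1]
  refine integral_congr_ae ?_
  filter_upwards [AEEqFun.coeFn_mk (fun ω : V → ℝ => ω ψ) (hm ψ).aestronglyMeasurable] with ω hω
  simp only [r, LinearMap.coe_mk, AddHom.coe_mk, hω]

/-- For finitely many ψ_j, the combination ∑ t_j Aψ_j is the inner product of t with the vector
field F = (Aψ_j), so the marginals are the laws given by `exists_charFun_eq_exp_neg`. -/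
theorem exists_stable_process {V X : Type*} [AddCommGroup V] [Module ℝ V] [MeasurableSpace X]
    {m : Measure X} [SigmaFinite m]
    {ν : Measure ℝ} [IsProbabilityMeasure ν] {β C M : ℝ} (hβ : 0 < β)
    (hM : ∀ ξ, ‖charFun ν ξ - 1‖ ≤ M * |ξ| ^ β)
    (hlim : Tendsto (fun ξ : ℝ => (charFun ν ξ - 1) / ((|ξ| ^ β : ℝ) : ℂ)) (𝓝[≠] 0)
      (𝓝 ((-C : ℝ) : ℂ)))
    (A : V →ₗ[ℝ] (X →ₘ[m] ℝ)) (hA : ∀ ψ, Integrable (fun x => |A ψ x| ^ β) m) :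
    ∃ (Q : Measure (V → ℝ)) (_ : IsProbabilityMeasure Q) (r : V →ₗ[ℝ] ((V → ℝ) →ₘ[Q] ℝ)),
      ∀ ψ, charFunctional r ψ = Complex.exp (-(C * ∫ x, |A ψ x| ^ β ∂m : ℝ)) := by
  refine exists_process_of_finite_marginals ?_ fun J => ?_
  · have : ∫ x, |A 0 x| ^ β ∂m = 0 := by
      refine integral_eq_zero_of_ae ?_
      rw [map_zero]
      filter_upwards [AEEqFun.coeFn_zero (α := X) (β := ℝ) (μ := m)] with x hx
      simp [hx, Real.zero_rpow hβ.ne']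
    rw [this]
    simp
  · have hF : MemLp (fun x => (WithLp.toLp 2 (fun j : J => A j x) : EuclideanSpace ℝ J))
        (ENNReal.ofReal β) m := MemLp.of_eval_piLp fun j =>
      (memLp_ofReal_iff_integrable_abs_rpow (A j).aestronglyMeasurable hβ).2 (hA j)
    have hFi := (integrable_norm_rpow_iff hF.1 (by simpa using hβ) ENNReal.ofReal_ne_top).2 hF
    rw [ENNReal.toReal_ofReal hβ.le] at hFi
    obtain ⟨ρ, hρ, hρt⟩ := exists_charFun_eq_exp_neg hβ hM hlim hF.1 hFi
    have hm : Measurable (WithLp.ofLp : EuclideanSpace ℝ J → (J → ℝ)) := by fun_prop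
    refine ⟨ρ.map WithLp.ofLp, Measure.isProbabilityMeasure_map hm.aemeasurable, fun t => ?_⟩
    have h1 := hρt (WithLp.toLp 2 t)
    have h2 : ∫ x, |A (∑ j, t j • (j : V)) x| ^ β ∂m
        = ∫ x, |(inner ℝ (WithLp.toLp 2 (fun j : J => A j x) : EuclideanSpace ℝ J)
          (WithLp.toLp 2 t) : ℝ)| ^ β ∂m := by
      refine integral_congr_ae ?_
      filter_upwards [coeFn_map_sum A Finset.univ t (fun j : J => (j : V))] with x hx
      rw [hx]
      simp [PiLp.inner_apply]
    rw [h2, ← h1, charFun_apply, integral_map hm.aemeasurable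
      (Continuous.aestronglyMeasurable (by fun_prop))]
    congr 1 with x
    rw [mul_comm]
    simp [PiLp.inner_apply]

/-! ### Continuity into `L^p` -/

/-- Hölder's inequality with the weight (1 + |x|)^{-N} in L^q, 1/q = 1/p - 1/2. It also covers p <
1, and p = 2 with q = ∞. -/
theorem exists_eLpNorm_le_mul_eLpNorm_two (d : ℕ) {p : ENNReal} (hp : p ≤ 2) :
    ∃ (N : ℕ) (K : ENNReal), K ≠ ⊤ ∧ ∀ f : Space d → ℝ, AEStronglyMeasurable f volume →
      eLpNorm f p volume ≤ K * eLpNorm (fun x => (1 + ‖x‖) ^ N * f x) 2 volume := by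
  let q : ENNReal := (p⁻¹ - 2⁻¹)⁻¹
  have hq : ENNReal.HolderTriple q 2 p :=
    ⟨by rw [inv_inv, tsub_add_cancel_of_le (ENNReal.inv_le_inv.2 hp)]⟩
  obtain ⟨N, hN⟩ := (inferInstance : (volume : Measure (Space d)).HasTemperateGrowth)
    |>.exists_eLpNorm_lt_top q
  refine ⟨N, _, hN.ne, fun f hf => ?_⟩
  have hm : AEStronglyMeasurable (fun x : Space d => (1 + ‖x‖) ^ N * f x) volume :=
    (Continuous.aestronglyMeasurable (by fun_prop)).mul hf
  have hw : AEStronglyMeasurable (fun x : Space d => (1 + ‖x‖) ^ (-(N : ℝ))) volume :=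
    Measurable.aestronglyMeasurable (by fun_prop)
  refine le_trans (le_of_eq ?_) (eLpNorm_smul_le_mul_eLpNorm (p := q) (q := 2) (r := p) hm hw)
  congr 1 with x
  have : (0 : ℝ) < 1 + ‖x‖ := by positivity
  rw [Pi.smul_apply', smul_eq_mul, Real.rpow_neg this.le, Real.rpow_natCast,
    inv_mul_cancel_left₀ (by positivity)]

theorem ContinuousIntoRapid.continuousIntoLp {d : ℕ}
    {A : TestFun d →ₗ[ℝ] (Space d →ₘ[volume] ℝ)} (hA : ContinuousIntoRapid A) {p : ℝ}
    (hp : p ≤ 2) : ContinuousIntoLp p A := by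
  obtain ⟨N, K, hK, hle⟩ := exists_eLpNorm_le_mul_eLpNorm_two d (p := ENNReal.ofReal p)
    (ENNReal.ofReal_le_of_le_toReal (by simpa using hp))
  refine ⟨fun φ => ⟨(A φ).aestronglyMeasurable, (hle _ (A φ).aestronglyMeasurable).trans_lt
    (ENNReal.mul_lt_top hK.lt_top (hA.1 φ N).2)⟩, fun φ₀ => ?_⟩
  have h0 := ENNReal.Tendsto.const_mul (hA.2 N φ₀) (Or.inr hK)
  rw [mul_zero] at h0
  exact tendsto_of_tendsto_of_tendsto_of_le_of_le tendsto_const_nhds h0 (fun _ => zero_le)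
    fun φ => hle _ ((A φ).aestronglyMeasurable.sub (A φ₀).aestronglyMeasurable)

theorem tendsto_eLpNorm_sub_testFun {d : ℕ} (p : ENNReal) (φ₀ : TestFun d) :
    Tendsto (fun φ : TestFun d => eLpNorm (fun x => φ x - φ₀ x) p volume) (𝓝 φ₀) (𝓝 0) := by
  obtain ⟨k, C, hC⟩ := SchwartzMap.eLpNorm_le_seminorm ℝ ℝ p (volume : Measure (Space d))
  let q : Seminorm ℝ (TestFun d) := (Finset.Iic (k, 0)).sup (schwartzSeminormFamily ℝ (Space d) ℝ)
  have hcont : Continuous q := by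
    refine Seminorm.continuous_of_le ?_ (Seminorm.finset_sup_le_sum _ _)
    have hsum : ⇑(∑ i ∈ Finset.Iic (k, 0), schwartzSeminormFamily ℝ (Space d) ℝ i)
        = fun f => ∑ i ∈ Finset.Iic (k, 0), schwartzSeminormFamily ℝ (Space d) ℝ i f := by
      ext f
      rw [← FunLike.coeAddMonoidHom_apply, map_sum, Finset.sum_apply]
      rfl
    rw [hsum]
    exact continuous_finsetSum _ fun i _ =>
      (schwartz_withSeminorms ℝ (Space d) ℝ).continuous_seminorm i
  have h1 : Tendsto (fun φ : TestFun d => (C : ENNReal) * ENNReal.ofReal (q (φ - φ₀)))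
      (𝓝 φ₀) (𝓝 0) := by
    have h2 : Continuous fun φ : TestFun d => ENNReal.ofReal (q (φ - φ₀)) :=
      ENNReal.continuous_ofReal.comp (hcont.comp (continuous_id.sub continuous_const))
    have h3 := ENNReal.Tendsto.const_mul (h2.tendsto φ₀) (Or.inr (ENNReal.coe_ne_top (r := C)))
    simpa using h3
  exact tendsto_of_tendsto_of_tendsto_of_le_of_le tendsto_const_nhds h1 (fun _ => zero_le)
    fun φ => hC (φ - φ₀)

/-- Meant for TL*, which is the identity: it handles the L*(𝓢) part of the domain under both (C1)
and (C2). -/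
theorem continuousIntoLp_of_ae_eq {d : ℕ} {A : TestFun d →ₗ[ℝ] (Space d →ₘ[volume] ℝ)}
    (hA : ∀ φ : TestFun d, (A φ : Space d → ℝ) =ᵐ[volume] φ) (p : ℝ) : ContinuousIntoLp p A := by
  refine ⟨fun φ => (memLp_congr_ae (hA φ)).2 (φ.memLp _ _), fun φ₀ => ?_⟩
  refine (tendsto_eLpNorm_sub_testFun (ENNReal.ofReal p) φ₀).congr fun φ =>
    eLpNorm_congr_ae ?_
  filter_upwards [hA φ, hA φ₀] with x h1 h2
  rw [h1, h2]

theorem integral_abs_rpow_eq {X : Type*} [MeasurableSpace X] {m : Measure X} {f : X → ℝ} {β : ℝ}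
    (hβ : 0 < β) (hf : MemLp f (ENNReal.ofReal β) m) :
    ∫ x, |f x| ^ β ∂m = (eLpNorm f (ENNReal.ofReal β) m).toReal ^ β := by
  have hI : 0 ≤ ∫ x, |f x| ^ β ∂m := integral_nonneg fun x => by positivity
  rw [hf.eLpNorm_eq_integral_rpow_norm (by simpa using hβ) ENNReal.ofReal_ne_top,
    ENNReal.toReal_ofReal hβ.le]
  simp only [Real.norm_eq_abs]
  rw [ENNReal.toReal_ofReal (by positivity), ← Real.rpow_mul hI, inv_mul_cancel₀ hβ.ne',
    Real.rpow_one]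

theorem isGeneralizedProcess_of_continuousIntoLp {d : ℕ} {Ω : Type*} [MeasurableSpace Ω]
    {P : Measure Ω} [IsProbabilityMeasure P] {r : TestFun d →ₗ[ℝ] (Ω →ₘ[P] ℝ)}
    {A : TestFun d →ₗ[ℝ] (Space d →ₘ[volume] ℝ)} {β C : ℝ} (hβ : 0 < β)
    (hA : ContinuousIntoLp β A)
    (hr : ∀ φ, charFunctional r φ = Complex.exp (-(C * ∫ x, |A φ x| ^ β : ℝ))) :
    IsGeneralizedProcess P r := by
  refine isGeneralizedProcess_of_charFunctional fun u φ hu t => ?_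
  have h1 : ∀ n, ∫ x, |A (t • (u n - φ)) x| ^ β
      = |t| ^ β * (eLpNorm (fun x => A (u n) x - A φ x) (ENNReal.ofReal β) volume).toReal ^ β := by
    intro n
    have hmem : MemLp (fun x => A (u n) x - A φ x) (ENNReal.ofReal β) volume :=
      (memLp_congr_ae (AEEqFun.coeFn_sub (A (u n)) (A φ))).1 (by rw [← map_sub]; exact hA.1 _)
    rw [← integral_abs_rpow_eq hβ hmem, ← integral_const_mul]
    refine integral_congr_ae ?_
    filter_upwards [AEEqFun.coeFn_sub (A (u n)) (A φ),
      AEEqFun.coeFn_smul t (A (u n) - A φ)] with x hx1 hx2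
    rw [map_smul, map_sub, hx2, Pi.smul_apply, hx1, smul_eq_mul, abs_mul,
      Real.mul_rpow (abs_nonneg _) (abs_nonneg _)]
    rfl
  have h2 : Tendsto (fun n => (eLpNorm (fun x => A (u n) x - A φ x)
      (ENNReal.ofReal β) volume).toReal) atTop (𝓝 0) := by
    simpa [Function.comp_def] using (ENNReal.tendsto_toReal ENNReal.zero_ne_top).comp ((hA.2 φ).comp hu)
  have hc : Continuous fun y : ℝ => Complex.exp (-(C * (|t| ^ β * y ^ β) : ℝ)) := by
    have : Continuous fun y : ℝ => y ^ β := Real.continuous_rpow_const hβ.le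
    fun_prop
  have h3 := (hc.tendsto 0).comp h2
  simp only [hr, h1]
  simpa [Function.comp_def, Real.zero_rpow hβ.ne'] using h3

/-! ### Behavior of the exponent -/

theorem tendsto_div_rpow_of_isEquivalent {Ψ : ℝ → ℂ} {β C : ℝ} (hC : 0 < C)
    (hΨ : Asymptotics.IsEquivalent (𝓝[≠] (0 : ℝ)) Ψ (fun ξ : ℝ => ((-C * |ξ| ^ β : ℝ) : ℂ))) :
    Tendsto (fun ξ : ℝ => Ψ ξ / ((|ξ| ^ β : ℝ) : ℂ)) (𝓝[≠] 0) (𝓝 ((-C : ℝ) : ℂ)) := by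
  have hpos : ∀ᶠ ξ : ℝ in 𝓝[≠] 0, ((|ξ| ^ β : ℝ) : ℂ) ≠ 0 := by
    filter_upwards [self_mem_nhdsWithin] with ξ hξ
    exact Complex.ofReal_ne_zero.2 (Real.rpow_pos_of_pos (abs_pos.2 hξ) β).ne'
  have hCc : ((C : ℝ) : ℂ) ≠ 0 := Complex.ofReal_ne_zero.2 hC.ne'
  have h1 := (Asymptotics.isEquivalent_iff_tendsto_one (by
    filter_upwards [hpos] with ξ hξ
    push_cast at hξ ⊢
    exact mul_ne_zero (neg_ne_zero.2 hCc) hξ)).1 hΨ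
  have h2 := h1.const_mul ((-C : ℝ) : ℂ)
  rw [mul_one] at h2
  refine h2.congr' ?_
  filter_upwards [hpos] with ξ hξ
  simp only [Pi.div_apply]
  push_cast at hξ ⊢
  field_simp

theorem exists_norm_le_mul_rpow_of_tendsto {g : ℝ → ℂ} (hg0 : g 0 = 0) {β : ℝ}
    {c : ℂ} (hlim : Tendsto (fun ξ : ℝ => g ξ / ((|ξ| ^ β : ℝ) : ℂ)) (𝓝[≠] 0) (𝓝 c)) :
    ∃ δ > 0, ∃ K : ℝ, 0 ≤ K ∧ ∀ ξ, |ξ| < δ → ‖g ξ‖ ≤ K * |ξ| ^ β := by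
  have h1 : ∀ᶠ ξ : ℝ in 𝓝[≠] 0, ‖g ξ / ((|ξ| ^ β : ℝ) : ℂ)‖ < ‖c‖ + 1 :=
    hlim.norm.eventually_lt_const (lt_add_one _)
  obtain ⟨δ, hδ, h2⟩ := Metric.mem_nhdsWithin_iff.1 h1
  refine ⟨δ, hδ, ‖c‖ + 1, by positivity, fun ξ hξ => ?_⟩
  rcases eq_or_ne ξ 0 with rfl | h0
  · rw [hg0, norm_zero]; positivity
  have h3 : ‖g ξ / ((|ξ| ^ β : ℝ) : ℂ)‖ < ‖c‖ + 1 := h2 ⟨by simpa using hξ, h0⟩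
  have hp := Real.rpow_pos_of_pos (abs_pos.2 h0) β
  rw [norm_div, Complex.norm_real, Real.norm_of_nonneg hp.le, div_lt_iff₀ hp] at h3
  exact h3.le

theorem IsLevyExponentOf.exists_norm_le {Ψ : ℝ → ℂ} {μ : Measure ℝ} (h : IsLevyExponentOf Ψ μ)
    {β : ℝ} {c : ℂ}
    (hlim : Tendsto (fun ξ : ℝ => Ψ ξ / ((|ξ| ^ β : ℝ) : ℂ)) (𝓝[≠] 0) (𝓝 c)) :
    ∃ M : ℝ, 0 ≤ M ∧ ∀ ξ, ‖Ψ ξ‖ ≤ M * (|ξ| ^ β + ξ ^ 2) := by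
  obtain ⟨δ, hδ, K, hK, h1⟩ := exists_norm_le_mul_rpow_of_tendsto h.map_zero hlim
  obtain ⟨M, hM, h2⟩ := h.exists_norm_le_mul_sq hδ
  refine ⟨K + M, by positivity, fun ξ => ?_⟩
  have h3 : 0 ≤ |ξ| ^ β := by positivity
  have h4 := sq_nonneg ξ
  rcases lt_or_ge |ξ| δ with hξ | hξ
  · nlinarith [h1 ξ hξ, mul_nonneg hM h3, mul_nonneg hM h4, mul_nonneg hK h4]
  · nlinarith [h2 ξ hξ, mul_nonneg hK h3, mul_nonneg hM h3, mul_nonneg hK h4]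

/-- Since (e^z - 1)/z → 1, the law of X itself can serve as the ν from which stable laws are built.
`dslope` takes care of points where Ψ vanishes. -/
theorem IsLevyExponentOf.tendsto_charFun_sub_one {Ψ : ℝ → ℂ} {μ : Measure ℝ}
    (h : IsLevyExponentOf Ψ μ) {β : ℝ} {c : ℂ}
    (hlim : Tendsto (fun ξ : ℝ => Ψ ξ / ((|ξ| ^ β : ℝ) : ℂ)) (𝓝[≠] 0) (𝓝 c)) :
    Tendsto (fun ξ : ℝ => (charFun μ ξ - 1) / ((|ξ| ^ β : ℝ) : ℂ)) (𝓝[≠] 0) (𝓝 c) := by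
  have h1 : ContinuousAt (dslope Complex.exp 0) 0 :=
    continuousAt_dslope_same.2 Complex.differentiableAt_exp
  have h2 : Tendsto (fun ξ => dslope Complex.exp 0 (Ψ ξ)) (𝓝[≠] 0) (𝓝 1) := by
    have h3 : Tendsto Ψ (𝓝[≠] 0) (𝓝 0) := by
      rw [← h.map_zero]
      exact (h.continuous.tendsto 0).mono_left nhdsWithin_le_nhds
    simpa [dslope_same, Function.comp_def] using h1.tendsto.comp h3
  have h4 := hlim.mul h2
  rw [mul_one] at h4
  refine h4.congr fun ξ => ?_
  have h5 := sub_smul_dslope Complex.exp 0 (Ψ ξ)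
  rw [sub_zero, smul_eq_mul, Complex.exp_zero] at h5
  rw [h.charFun_eq, ← h5]
  ring

theorem exists_norm_charFun_sub_one_le {μ : Measure ℝ} [IsProbabilityMeasure μ] {β : ℝ}
    (hβ : 0 < β) {c : ℂ}
    (hlim : Tendsto (fun ξ : ℝ => (charFun μ ξ - 1) / ((|ξ| ^ β : ℝ) : ℂ)) (𝓝[≠] 0) (𝓝 c)) :
    ∃ M : ℝ, ∀ ξ, ‖charFun μ ξ - 1‖ ≤ M * |ξ| ^ β := by
  obtain ⟨δ, hδ, K, hK, h1⟩ := exists_norm_le_mul_rpow_of_tendsto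
    (g := fun ξ => charFun μ ξ - 1) (by simp) hlim
  have hδβ := Real.rpow_pos_of_pos hδ β
  refine ⟨K + 2 / δ ^ β, fun ξ => ?_⟩
  have h3 : 0 ≤ |ξ| ^ β := by positivity
  rcases lt_or_ge |ξ| δ with hξ | hξ
  · have := h1 ξ hξ
    have : 0 ≤ 2 / δ ^ β * |ξ| ^ β := by positivity
    linarith
  · have h4 : δ ^ β ≤ |ξ| ^ β := Real.rpow_le_rpow hδ.le hξ hβ.le
    have h5 : 2 ≤ 2 / δ ^ β * |ξ| ^ β := by
      rw [div_mul_eq_mul_div, le_div_iff₀ hδβ]; linarith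
    have h6 : ‖charFun μ ξ - 1‖ ≤ 2 := by
      rw [norm_sub_rev]; exact norm_one_sub_charFun_le_two
    nlinarith [mul_nonneg hK h3]

/-! ### Scaling -/

/-- This is where the exponent H comes from: T contributes a^{-γ} and the pairing a^d, so the
amplitude is a^{H + d - γ} = (a^d)^{1/β}, while the change of variables yields a^{-d}. -/
theorem integral_comp_map_dilate {d : ℕ} {β γ : ℝ}
    {A : TestFun d →ₗ[ℝ] (Space d →ₘ[volume] ℝ)} (hA : IsHomogeneousMap (-γ) A)
    {F : Type*} [NormedAddCommGroup F] [NormedSpace ℝ F] (g : ℝ → F) {a : ℝ} (ha : 0 < a)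
    (φ : TestFun d) :
    ∫ x, g (A (a ^ (γ + d * (1 / β - 1)) • a ^ d • dilate a φ) x)
      = (a ^ d)⁻¹ • ∫ x, g ((a ^ d) ^ (1 / β) * A φ x) := by
  have hn : Module.finrank ℝ (Space d) = d := by simp
  have h1 : ∫ x, g (A (a ^ (γ + d * (1 / β - 1)) • a ^ d • dilate a φ) x)
      = ∫ x, g ((a ^ d) ^ (1 / β) * A φ (a • x)) := by
    refine integral_congr_ae ?_
    -- φ(a·) is the dilation φ(·/a⁻¹).
    have h2 := hA a⁻¹ (inv_pos.2 ha) φ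
    rw [inv_inv, neg_neg] at h2
    filter_upwards [h2, AEEqFun.coeFn_smul (a ^ (γ + d * (1 / β - 1)))
      (A (a ^ d • dilate a φ)), AEEqFun.coeFn_smul (a ^ d) (A (dilate a φ))] with x h3 h4 h5
    rw [map_smul, h4, Pi.smul_apply, map_smul, h5, Pi.smul_apply, h3, smul_eq_mul, smul_eq_mul,
      ← mul_assoc, ← mul_assoc]
    congr 2
    rw [Real.inv_rpow ha.le, ← Real.rpow_neg ha.le, ← Real.rpow_natCast, ← Real.rpow_add ha,
      ← Real.rpow_add ha, ← Real.rpow_mul ha.le]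
    congr 1
    ring
  rw [h1, Measure.integral_comp_smul volume (fun y => g ((a ^ d) ^ (1 / β) * A φ y)) a, hn,
    abs_of_pos (by positivity)]

theorem charFunctional_smul_rescale {d : ℕ} {Ω : Type*} [MeasurableSpace Ω] {P : Measure Ω}
    (s : TestFun d →ₗ[ℝ] (Ω →ₘ[P] ℝ)) (b a : ℝ) (φ : TestFun d) :
    charFunctional (b • rescale s a) φ = charFunctional s (b • a ^ d • dilate a φ) := by
  have : (b • rescale s a) φ = s (b • a ^ d • dilate a φ) := by
    rw [map_smul, map_smul]; rfl
  simp only [charFunctional, this]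

/-- The scaling identity with ε = a^d, which tends to 0 because d ≥ 1. -/
theorem tendsto_charFunctional_rescale {d : ℕ} (hd : 1 ≤ d) {Ω : Type*} [MeasurableSpace Ω]
    {P : Measure Ω} {Ψ : ℝ → ℂ} (hΨc : Continuous Ψ) (hΨ0 : Ψ 0 = 0) {β γ C : ℝ} (hβ : 0 < β)
    (hlim : Tendsto (fun ξ : ℝ => Ψ ξ / ((|ξ| ^ β : ℝ) : ℂ)) (𝓝[≠] 0) (𝓝 ((-C : ℝ) : ℂ)))
    {A : TestFun d →ₗ[ℝ] (Space d →ₘ[volume] ℝ)} (hA : IsHomogeneousMap (-γ) A)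
    {B : ℝ → ℝ} (hB : ∀ ε : ℝ, 0 < ε → ε ≤ 1 → ∀ y, ‖Ψ (ε ^ (1 / β) * y)‖ ≤ ε * B y)
    (hBA : ∀ φ, Integrable (fun x => B (A φ x)))
    {s : TestFun d →ₗ[ℝ] (Ω →ₘ[P] ℝ)}
    (hs : ∀ φ, charFunctional s φ = noiseFunctional Ψ (A φ)) (φ : TestFun d) :
    Tendsto (fun a : ℝ => charFunctional (a ^ (γ + d * (1 / β - 1)) • rescale s a) φ) (𝓝[>] 0)
      (𝓝 (Complex.exp (-(C * ∫ x, |A φ x| ^ β : ℝ)))) := by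
  have h1 := tendsto_inv_mul_integral_comp_rpow_mul hΨc hΨ0 hβ hlim hB
    (A φ).aestronglyMeasurable (hBA φ)
  have h2 : Tendsto (fun a : ℝ => a ^ d) (𝓝[>] 0) (𝓝[>] 0) := by
    refine tendsto_nhdsWithin_iff.2 ⟨?_, ?_⟩
    · have := ((continuous_pow d).tendsto (0 : ℝ)).mono_left
        (nhdsWithin_le_nhds (s := Set.Ioi (0 : ℝ)))
      rwa [zero_pow (by omega)] at this
    · filter_upwards [self_mem_nhdsWithin] with a ha
      exact pow_pos (Set.mem_Ioi.1 ha) d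
  have h3 := (Complex.continuous_exp.tendsto _).comp (h1.comp h2)
  rw [Complex.ofReal_neg] at h3
  refine h3.congr' ?_
  filter_upwards [self_mem_nhdsWithin] with a ha
  rw [charFunctional_smul_rescale, hs, noiseFunctional,
    integral_comp_map_dilate (β := β) hA Ψ ha φ]
  simp only [Function.comp_apply, Complex.real_smul]

/-- For the pure power |y|^β the factors ε⁻¹ and ε cancel exactly, at every scale. -/
theorem isSelfSimilar_of_charFunctional {d : ℕ} {Ω : Type*} [MeasurableSpace Ω]
    {P : Measure Ω} [IsProbabilityMeasure P] {β γ C : ℝ} (hβ : 0 < β)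
    {A : TestFun d →ₗ[ℝ] (Space d →ₘ[volume] ℝ)} (hA : IsHomogeneousMap (-γ) A)
    {r : TestFun d →ₗ[ℝ] (Ω →ₘ[P] ℝ)}
    (hr : ∀ φ, charFunctional r φ = Complex.exp (-(C * ∫ x, |A φ x| ^ β : ℝ))) :
    IsSelfSimilar (γ + d * (1 / β - 1)) r := fun a ha =>
  equalInLaw_of_charFunctional_eq fun φ => by
    have had : 0 < a ^ d := pow_pos ha d
    rw [charFunctional_smul_rescale, hr, hr,
      integral_comp_map_dilate (β := β) hA (fun y => |y| ^ β) ha φ]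
    simp only [rpow_one_div_mul_rpow hβ had]
    rw [integral_const_mul, smul_eq_mul, inv_mul_cancel_left₀ had.ne']

theorem ne_zero_of_charFunctional {Ω V X : Type*} [MeasurableSpace Ω] [AddCommGroup V]
    [Module ℝ V] [MeasurableSpace X] {m : Measure X}
    {P : Measure Ω} [IsProbabilityMeasure P] {β C : ℝ} (hβ : 0 < β) (hC : 0 < C)
    {A : V →ₗ[ℝ] (X →ₘ[m] ℝ)} (hA : A ≠ 0)
    (hAi : ∀ φ, Integrable (fun x => |A φ x| ^ β) m)
    {r : V →ₗ[ℝ] (Ω →ₘ[P] ℝ)}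
    (hr : ∀ φ, charFunctional r φ = Complex.exp (-(C * ∫ x, |A φ x| ^ β ∂m : ℝ))) : r ≠ 0 := by
  rintro rfl
  refine hA (LinearMap.ext fun φ => AEEqFun.ext ?_)
  have h1 : charFunctional (0 : V →ₗ[ℝ] (Ω →ₘ[P] ℝ)) φ = 1 := by
    have : charFunctional (0 : V →ₗ[ℝ] (Ω →ₘ[P] ℝ)) φ = ∫ _, (1 : ℂ) ∂P := by
      refine integral_congr_ae ?_
      filter_upwards [AEEqFun.coeFn_zero (α := Ω) (β := ℝ) (μ := P)] with ω hω
      simp [LinearMap.zero_apply, hω]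
    simpa using this
  rw [hr, ← Complex.ofReal_neg, ← Complex.ofReal_exp, Complex.ofReal_eq_one, Real.exp_eq_one_iff,
    neg_eq_zero, mul_eq_zero, or_iff_right hC.ne',
    integral_eq_zero_iff_of_nonneg (fun x => by positivity) (hAi φ)] at h1
  filter_upwards [h1, AEEqFun.coeFn_zero (α := X) (β := ℝ) (μ := m)] with x hx h0
  rw [LinearMap.zero_apply, h0]
  simpa [Real.rpow_eq_zero (abs_nonneg _) hβ.ne'] using hx

/-- Domination of the rescaled exponent under either of the two conditions on `A`. -/
theorem IsLevyExponentOf.exists_dominating {d : ℕ} {Ψ : ℝ → ℂ} {μ : Measure ℝ}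
    (h : IsLevyExponentOf Ψ μ) {β C : ℝ} (hβ : β ∈ Set.Ioc (0 : ℝ) 2)
    (hlim : Tendsto (fun ξ : ℝ => Ψ ξ / ((|ξ| ^ β : ℝ) : ℂ)) (𝓝[≠] 0) (𝓝 ((-C : ℝ) : ℂ)))
    {A : TestFun d →ₗ[ℝ] (Space d →ₘ[volume] ℝ)}
    (hA : ContinuousIntoRapid A ∨ (ContinuousIntoLp β A ∧ IsAdmissible β Ψ)) :
    ∃ B : ℝ → ℝ, (∀ ε : ℝ, 0 < ε → ε ≤ 1 → ∀ y, ‖Ψ (ε ^ (1 / β) * y)‖ ≤ ε * B y) ∧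
      ∀ φ, Integrable (fun x => B (A φ x)) := by
  have hint : ContinuousIntoLp β A → ∀ φ, Integrable (fun x => |A φ x| ^ β) := fun hA φ =>
    (memLp_ofReal_iff_integrable_abs_rpow (A φ).aestronglyMeasurable hβ.1).1 (hA.1 φ)
  rcases hA with hA | ⟨hA, C', hC', hadm⟩
  · obtain ⟨M, hM, hΨ⟩ := h.exists_norm_le hlim
    refine ⟨fun y => M * (|y| ^ β + y ^ 2), fun ε hε hε1 y => ?_, fun φ => ?_⟩
    · refine (hΨ _).trans ?_
      rw [rpow_one_div_mul_rpow hβ.1 hε, mul_pow]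
      -- ε^{2/β} ≤ ε because 2/β ≥ 1 and ε ≤ 1: the quadratic term is harmless exactly because β ≤
      -- 2.
      have h2 : (ε ^ (1 / β)) ^ 2 ≤ ε := by
        rw [← Real.rpow_natCast, ← Real.rpow_mul hε.le]
        refine (Real.rpow_le_rpow_of_exponent_ge hε hε1 (z := 1) ?_).trans_eq (Real.rpow_one ε)
        rw [div_mul_eq_mul_div, le_div_iff₀ hβ.1]
        push_cast
        linarith [hβ.2]
      have h3 := mul_le_mul_of_nonneg_right h2 (sq_nonneg y)
      calc M * (ε * |y| ^ β + (ε ^ (1 / β)) ^ 2 * y ^ 2)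
          ≤ M * (ε * |y| ^ β + ε * y ^ 2) := by gcongr
        _ = ε * (M * (|y| ^ β + y ^ 2)) := by ring
    · have h2 : MemLp (A φ) 2 volume := by simpa using hA.1 φ 0
      exact ((hint (hA.continuousIntoLp hβ.2) φ).add h2.integrable_sq).const_mul M
  · refine ⟨fun y => C' * |y| ^ β, fun ε hε _ y => ?_, fun φ => (hint hA φ).const_mul C'⟩
    refine (hadm _).trans_eq ?_
    rw [rpow_one_div_mul_rpow hβ.1 hε]
    ring

theorem integrable_abs_rpow_extSpace {d : ℕ} {β : ℝ} (hβ : 0 < β)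
    {L : TestFun d →L[ℝ] Distr d} {T : extSpace L →ₗ[ℝ] (Space d →ₘ[volume] ℝ)}
    (h₁ : ContinuousIntoLp β (T.comp (inclExt L)))
    (h₂ : ContinuousIntoLp β (T.comp (adjointExt L))) (ψ : extSpace L) :
    Integrable (fun x => |T ψ x| ^ β) volume := by
  obtain ⟨_, ⟨φ₁, rfl⟩, _, ⟨φ₂, rfl⟩, hψ⟩ := Submodule.mem_sup.1 ψ.2
  have hψ' : ψ = inclExt L φ₁ + adjointExt L φ₂ := Subtype.ext hψ.symm
  refine (memLp_ofReal_iff_integrable_abs_rpow (T ψ).aestronglyMeasurable hβ).1 ?_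
  rw [hψ', map_add]
  exact (memLp_congr_ae (AEEqFun.coeFn_add _ _)).2 ((h₁.1 φ₁).add (h₂.1 φ₂))

end LevySDE

end

/-! ### Assembly of the theorem -/

theorem mainTheorem1 {d : ℕ} (hd : 1 ≤ d)
    -- the Lévy white noise `w`, its exponent and its index
    {Ω₀ : Type*} [MeasurableSpace Ω₀] (P₀ : Measure Ω₀) [IsProbabilityMeasure P₀]
    (Ψ : ℝ → ℂ) (w : LevySDE.TestFun d →ₗ[ℝ] (Ω₀ →ₘ[P₀] ℝ))
    (hw : LevySDE.IsLevyWhiteNoise P₀ Ψ w)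
    (β₀ : ℝ) (hβ₀ : β₀ = LevySDE.pruittIndex Ψ) (hβ₀_mem : β₀ ∈ Set.Ioc (0 : ℝ) 2)
    -- the homogeneous operator `L` and the homogeneous left inverse `T` of its adjoint
    (γ : ℝ) (hγ : 0 ≤ γ)
    (L : LevySDE.TestFun d →L[ℝ] LevySDE.Distr d)
    (hL : LevySDE.IsHomogeneousOperator γ L)
    (T : LevySDE.extSpace L →ₗ[ℝ] (LevySDE.Space d →ₘ[volume] ℝ))
    (hT_inv : LevySDE.IsLeftInverseOfAdjoint L T)
    (hT_hom : LevySDE.IsHomogeneousMap (-γ) (T.comp (LevySDE.inclExt L)))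
    -- non-degeneracy, automatic as soon as `L* φ` is a test function for one `φ ≠ 0` in `𝓢`
    (hT_ne : T.comp (LevySDE.inclExt L) ≠ 0)
    -- condition (C1) or condition (C2)
    (hT : LevySDE.ContinuousIntoRapid (T.comp (LevySDE.inclExt L)) ∨
      (LevySDE.ContinuousIntoLp β₀ (T.comp (LevySDE.inclExt L)) ∧ LevySDE.IsAdmissible β₀ Ψ))
    -- the linear process `s = L⁻¹ w`
    {Ω : Type*} [MeasurableSpace Ω] (P : Measure Ω) [IsProbabilityMeasure P]
    (s : LevySDE.TestFun d →ₗ[ℝ] (Ω →ₘ[P] ℝ))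
    (hs : LevySDE.IsGeneralizedProcess P s)
    (hs_char : ∀ φ : LevySDE.TestFun d,
      LevySDE.charFunctional s φ = LevySDE.noiseFunctional Ψ (T (LevySDE.inclExt L φ)))
    -- the behavior of `Ψ` at the origin
    (C : ℝ) (hC : 0 < C)
    (hΨ : Asymptotics.IsEquivalent (𝓝[≠] (0 : ℝ)) Ψ
      (fun ξ : ℝ => ((-C * |ξ| ^ β₀ : ℝ) : ℂ))) :
    -- the limit process `s_{L,β₀}`, as a process on `𝓢 + L*(𝓢)`
    (∃ (Ω' : Type) (_ : MeasurableSpace Ω') (P' : Measure Ω') (_ : IsProbabilityMeasure P')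
      (sLim : LevySDE.extSpace L →ₗ[ℝ] (Ω' →ₘ[P'] ℝ)),
      LevySDE.IsGeneralizedProcess P' (sLim.comp (LevySDE.inclExt L)) ∧
      (∀ ψ : LevySDE.extSpace L,
        Integrable (fun x => |T ψ x| ^ β₀) volume ∧
        LevySDE.charFunctional sLim ψ = Complex.exp (-(C * ∫ x, |T ψ x| ^ β₀ : ℝ))) ∧
      -- `L s_{L,β₀}`, that is `φ ↦ ⟨s_{L,β₀}, L* φ⟩`, is a stable white noise
      LevySDE.IsStableWhiteNoise P' β₀ C (sLim.comp (LevySDE.adjointExt L)) ∧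
      LevySDE.ConvergesInLaw (𝓝[>] (0 : ℝ))
        (fun a => a ^ (γ + d * (1 / β₀ - 1)) • LevySDE.rescale s a)
        (sLim.comp (LevySDE.inclExt L)) ∧
      LevySDE.IsSelfSimilar (γ + d * (1 / β₀ - 1)) (sLim.comp (LevySDE.inclExt L))) ∧
    LevySDE.IsAsymptoticallySelfSimilar (γ + d * (1 / β₀ - 1)) s := by
  obtain ⟨μ, hμ, -⟩ := hw.exponent
  have hμp := hμ.isProbabilityMeasure
  have hβ := hβ₀_mem.1
  have hlim := LevySDE.tendsto_div_rpow_of_isEquivalent hC hΨ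
  have hlimμ := hμ.tendsto_charFun_sub_one hlim
  obtain ⟨M, hM⟩ := LevySDE.exists_norm_charFun_sub_one_le hβ hlimμ
  have hS : LevySDE.ContinuousIntoLp β₀ (T.comp (LevySDE.inclExt L)) :=
    hT.elim (fun h => h.continuousIntoLp hβ₀_mem.2) fun h => h.1
  have hS' : LevySDE.ContinuousIntoLp β₀ (T.comp (LevySDE.adjointExt L)) :=
    LevySDE.continuousIntoLp_of_ae_eq (A := T.comp (LevySDE.adjointExt L)) (fun φ => hT_inv φ) β₀
  have hint := LevySDE.integrable_abs_rpow_extSpace hβ hS hS'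
  have hex := fun A hA => LevySDE.exists_stable_process (V := LevySDE.extSpace L)
    (m := (volume : Measure (LevySDE.Space d))) hβ hM hlimμ A hA
  -- A single process on 𝓢 + L*(𝓢): its restriction to 𝓢 is the scaling limit, and its composition
  -- with L* is the stable noise.
  obtain ⟨Q, hQ, r, hr⟩ := hex T hint
  obtain ⟨B, hB, hBA⟩ := hμ.exists_dominating hβ₀_mem hlim hT
  have hgen := LevySDE.isGeneralizedProcess_of_continuousIntoLp (r := r.comp (LevySDE.inclExt L))
    hβ hS fun φ => hr (LevySDE.inclExt L φ)
  have hconv : LevySDE.ConvergesInLaw (𝓝[>] (0 : ℝ))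
      (fun a => a ^ (γ + d * (1 / β₀ - 1)) • LevySDE.rescale s a)
      (r.comp (LevySDE.inclExt L)) :=
    LevySDE.convergesInLaw_of_charFunctional fun φ => by
      have h := LevySDE.tendsto_charFunctional_rescale hd hμ.continuous hμ.map_zero hβ hlim hT_hom
        hB hBA hs_char φ
      rw [LinearMap.comp_apply, ← hr] at h
      exact h
  refine ⟨⟨LevySDE.extSpace L → ℝ, inferInstance, Q, hQ, r, hgen, fun ψ => ⟨hint ψ, hr ψ⟩, ⟨?_, hβ₀_mem, hC, ?_⟩, hconv,
    LevySDE.isSelfSimilar_of_charFunctional hβ hT_hom fun φ => hr (LevySDE.inclExt L φ)⟩,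
    ⟨LevySDE.extSpace L → ℝ, inferInstance, Q, hQ, r.comp (LevySDE.inclExt L), hgen, ?_, hconv⟩⟩
  · exact LevySDE.isGeneralizedProcess_of_continuousIntoLp hβ hS'
      fun φ => hr (LevySDE.adjointExt L φ)
  · intro φ
    have h : ∫ x, |T (LevySDE.adjointExt L φ) x| ^ β₀ = ∫ x, |φ x| ^ β₀ :=
      integral_congr_ae ((hT_inv φ).mono fun x hx => by simp only [hx])
    rw [← h]
    exact hr (LevySDE.adjointExt L φ)
  · exact LevySDE.ne_zero_of_charFunctional hβ hC hT_ne
      (fun φ => hint (LevySDE.inclExt L φ)) fun φ => hr (LevySDE.inclExt L φ)
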